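/- For $r_1<r_2$ let $$h_{r_1,r_2}(s)=\begin{cases}1,& s\le r_1\\ \dfrac{e^{1/(s-r_1)}}{e^{1/(s-r_1)}+e^{1/(r_2-s)}},& r_1<s<r_2\\ 0,& s\ge r_2\end{cases}\qquad g_{r_1,r_2}(s)=\begin{cases}0,& s\le r_1\\ \dfrac{e^{1/(r_2-s)}}{e^{1/(s-r_1)}+e^{1/(r_2-s)}},& r_1<s<r_2\\ 1,& s\ge r_2\end{cases}$$ and let $f_{r_1,r_2}$ be $0$ outside $(r_1,r_2)$, equal to $g_{r_1,(r_1+r_2)/2}$ on $(r_1,\frac{r_1+r_2}2]$ and to $h_{(r_1+r_2)/2,r_2}$ on $(\frac{r_1+r_2}2,r_2)$. Let $\kappa_1,\kappa_2$ be the $8$-periodic functions given on $[0,8]$ by $$\kappa_1=\tfrac{\pi}{3}\left(f_{0,2}-2f_{2,4}+3f_{4,6}-f_{6,8}\right),\qquad \kappa_2=\tfrac{\pi}{3}\left(f_{0,2}+3f_{2,4}-2f_{4,6}-f_{6,8}\right),$$ let $\kappa_3$ be the $16$-periodic function equal to $\kappa_1$ on $[0,8]$ and to $\kappa_2$ on $(8,16]$,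 and let $\kappa_4$ be the $24$-periodic function equal to $\kappa_1$ on $[0,8]$, to $\kappa_2$ on $(8,16]$ and to $\kappa_1$ on $(16,24]$. For $i=1,\dots,4$ let $$\gamma_i(s)=\left(\int_0^s\cos\eta_i(\tau)\,d\tau,\ \int_0^s\sin\eta_i(\tau)\,d\tau\right),\qquad \eta_i(s)=\int_0^s\kappa_i(\tau)\,d\tau,$$ and let $\Gamma_i=\gamma_i(\mathbb R)$, oriented by $\gamma_i$. Terminology. The signature map of a unit speed parametrization with curvature $\kappa$ is $\sigma(s)=(\kappa(s),\kappa'(s))$, and the signature is its image. A vertex is a point of the curve at which $\kappa'=0$; a curve is non-degenerate if its vertices are isolated. A curve is simple if each of its points has a neighbourhood in the plane whose intersection with the curve is homeomorphic to $\mathbb R$ or to a half-open interval. The signature index is the minimum, over the points $p$ of the curve, of the number of points of the curve with the same signature as $p$. Two oriented curves are congruent if an element of the special Euclidean group $SE(2)$ maps one onto the other, preserving orientation; the symmetry group of an oriented curve consists of the elements of $SE(2)$ that map it onto itself, preserving orientation. The length of a closed curve is the minimal period of its arc-length parametrization. Then: 1. $\kappa_1,\kappa_2,\kappa_3,\kappa_4$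 are $C^\infty$ with minimal periods $8,8,16,24$. For every integer $n$ the restriction of $\kappa_2$ to $[2n,2n+2]$ is a translate of the restriction of $\kappa_1$ to $[2m,2m+2]$ for some integer $m$, and vice versa, but there is no $c\in\mathbb R$ with $\kappa_2(s)=\kappa_1(s+c)$ for all $s$. 2. Each $\gamma_i$ is a $C^\infty$ unit speed parametrization with curvature $\kappa_i$ of a closed, simple, non-degenerate curve $\Gamma_i$ of length $48$ and signature index $6$. 3. The four curves have identical signatures but are pairwise non-congruent. 4. The symmetry groups of $\Gamma_1,\Gamma_2,\Gamma_3,\Gamma_4$ are isomorphic to $\mathbb Z_6,\mathbb Z_6,\mathbb Z_3,\mathbb Z_2$ respectively. 5. The curve pieces $\gamma_1|_{[0,8]}$ and $\gamma_2|_{[0,8]}$ have the same signature, but there is no continuous map $\rho\colon[0,8]\to[0,8]$ (surjective or not) such that $\kappa_2=\kappa_1\circ\rho$ on $[0,8]$ and $\rho$ is differentiable with $\rho'(s)=1$ at every $s\in[0,8]$ for which $\gamma_1(\rho(s))$ is not a vertex of $\gamma_1|_{[0,8]}$. In particular, non-degenerate $C^\infty$ closed plane curves with equal Euclidean signatures need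 not be congruent. -/

import Mathlib

open scoped ContDiff

noncomputable section

namespace SignatureCurves

/-- The Euclidean plane. -/
abbrev Plane : Type := EuclideanSpace ℝ (Fin 2)

/-! ## Parametrized plane curves -/

/-- `det (v, w)` for two plane vectors. -/
def det2 (v w : Plane) : ℝ := v 0 * w 1 - v 1 * w 0

/-- Signed Euclidean curvature of a regular parametrization. -/
def curvature (γ : ℝ → Plane) (t : ℝ) : ℝ :=
  det2 (deriv γ t) (iteratedDeriv 2 γ t) / ‖deriv γ t‖ ^ 3

/-- Derivative of the curvature with respect to arc length. -/
def curvatureDot (γ : ℝ → Plane) (t : ℝ) : ℝ :=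
  deriv (curvature γ) t / ‖deriv γ t‖

/-- The parametrized signature map. -/
def signatureMap (γ : ℝ → Plane) (t : ℝ) : ℝ × ℝ := (curvature γ t, curvatureDot γ t)

/-- The Euclidean signature (a subset of the plane). -/
def signature (γ : ℝ → Plane) : Set (ℝ × ℝ) := Set.range (signatureMap γ)

/-- `L` is the smallest positive period of `f`. -/
def IsMinimalPeriod {α : Type*} (f : ℝ → α) (L : ℝ) : Prop :=
  0 < L ∧ Function.Periodic f L ∧ ∀ T : ℝ, 0 < T → Function.Periodic f T → L ≤ T

/-- Unit speed parametrization. -/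
def IsUnitSpeed (γ : ℝ → Plane) : Prop := ∀ s : ℝ, ‖deriv γ s‖ = 1

/-- `γ` is an arc-length parametrization of a closed curve of length `L`. -/
def IsClosedOfLength (γ : ℝ → Plane) (L : ℝ) : Prop :=
  IsUnitSpeed γ ∧ IsMinimalPeriod γ L

/-- A point of `Γ` near which `Γ` is, in the subset topology, a line or a half-open interval. -/
def IsSimplePoint (Γ : Set Plane) (p : Plane) : Prop :=
  p ∈ Γ ∧ ∃ U : Set Plane, IsOpen U ∧ p ∈ U ∧
    (Nonempty (↥(Γ ∩ U) ≃ₜ ℝ) ∨ Nonempty (↥(Γ ∩ U) ≃ₜ ↥(Set.Ico (0 : ℝ) 1)))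

/-- A curve is simple if all its points are simple. -/
def IsSimple (γ : ℝ → Plane) : Prop := ∀ p ∈ Set.range γ, IsSimplePoint (Set.range γ) p

/-- The set of vertices: the points of the curve at which the arc-length derivative of the
curvature vanishes. -/
def vertexSet (γ : ℝ → Plane) : Set Plane := {p | ∃ t : ℝ, γ t = p ∧ curvatureDot γ t = 0}

/-- A curve is non-degenerate if its vertices are isolated. -/
def IsNonDegenerate (γ : ℝ → Plane) : Prop :=
  ∀ p ∈ vertexSet γ, ∃ U : Set Plane, IsOpen U ∧ vertexSet γ ∩ U = {p}

/-- Local signature index at the point `γ t`: the number of points of the curve with the same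
signature as `γ t`. -/
def localSignatureIndex (γ : ℝ → Plane) (t : ℝ) : ℕ∞ :=
  Set.encard {q : Plane | ∃ u : ℝ, γ u = q ∧ signatureMap γ u = signatureMap γ t}

/-- Global signature index: the minimum of the local ones. -/
def signatureIndex (γ : ℝ → Plane) : ℕ∞ := ⨅ t : ℝ, localSignatureIndex γ t

/-! ## Congruence and symmetry -/

/-- The special Euclidean group: isometries of the plane whose linear part has determinant 1. -/
def SE2 : Subgroup (Plane ≃ᵃⁱ[ℝ] Plane) where
  carrier := {g | LinearMap.det (g.linearIsometryEquiv.toLinearEquiv : Plane →ₗ[ℝ] Plane) = 1}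
  one_mem' := by
    have h : ((1 : Plane ≃ᵃⁱ[ℝ] Plane).linearIsometryEquiv.toLinearEquiv : Plane →ₗ[ℝ] Plane)
        = LinearMap.id := rfl
    simp only [Set.mem_ofPred_eq, h, LinearMap.det_id]
  mul_mem' := by
    intro a b ha hb
    have h : ((a * b).linearIsometryEquiv.toLinearEquiv : Plane →ₗ[ℝ] Plane)
        = (a.linearIsometryEquiv.toLinearEquiv : Plane →ₗ[ℝ] Plane) ∘ₗ
          (b.linearIsometryEquiv.toLinearEquiv : Plane →ₗ[ℝ] Plane) := rfl
    simp only [Set.mem_ofPred_eq] at ha hb ⊢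
    rw [h, LinearMap.det_comp, ha, hb, one_mul]
  inv_mem' := by
    intro a ha
    have h : ((a⁻¹).linearIsometryEquiv.toLinearEquiv : Plane →ₗ[ℝ] Plane)
        = (a.linearIsometryEquiv.toLinearEquiv.symm : Plane →ₗ[ℝ] Plane) := rfl
    simp only [Set.mem_ofPred_eq] at ha ⊢
    have h2 := LinearEquiv.det_symm_mul_det a.linearIsometryEquiv.toLinearEquiv
    rw [ha, mul_one] at h2
    rw [h, h2]

/-- The orientation of a curve: its simple points together with the unit tangent vectors
that the parametrization induces there. -/
def orientation (γ : ℝ → Plane) : Set (Plane × Plane) :=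
  {x | ∃ t : ℝ, IsSimplePoint (Set.range γ) (γ t) ∧
    x = (γ t, ‖deriv γ t‖⁻¹ • deriv γ t)}

/-- The action of an isometry on pairs (point, tangent vector at that point). -/
def tangentAction (g : Plane ≃ᵃⁱ[ℝ] Plane) (x : Plane × Plane) : Plane × Plane :=
  (g x.1, g.linearIsometryEquiv x.2)

/-- `g · Γ₁ = Γ₂` as oriented curves: equality of sets and of orientations. -/
def MapsOnto (g : Plane ≃ᵃⁱ[ℝ] Plane) (γ₁ γ₂ : ℝ → Plane) : Prop :=
  g '' Set.range γ₁ = Set.range γ₂ ∧ tangentAction g '' orientation γ₁ = orientation γ₂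

/-- Congruence of oriented plane curves. -/
def Congruent (γ₁ γ₂ : ℝ → Plane) : Prop := ∃ g ∈ SE2, MapsOnto g γ₁ γ₂

/-- The symmetry group of an oriented plane curve. -/
def symmetryGroup (γ : ℝ → Plane) : Subgroup (Plane ≃ᵃⁱ[ℝ] Plane) where
  carrier := {g | g ∈ SE2 ∧ MapsOnto g γ γ}
  one_mem' := by
    refine ⟨SE2.one_mem, ?_, ?_⟩
    · change (fun x : Plane => x) '' _ = _
      exact Set.image_id' _
    · change (fun x : Plane × Plane => x) '' _ = _
      exact Set.image_id' _
  mul_mem' := by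
    rintro a b ⟨ha, ha1, ha2⟩ ⟨hb, hb1, hb2⟩
    refine ⟨SE2.mul_mem ha hb, ?_, ?_⟩
    · change (fun x : Plane => a (b x)) '' _ = _
      rw [← Set.image_image, hb1, ha1]
    · change (fun x : Plane × Plane => tangentAction a (tangentAction b x)) '' _ = _
      rw [← Set.image_image, hb2, ha2]
  inv_mem' := by
    rintro a ⟨ha, ha1, ha2⟩
    have e1 : ∀ x : Plane, a⁻¹ (a x) = x := fun x => a.symm_apply_apply x
    have e2 : ∀ x : Plane × Plane, tangentAction a⁻¹ (tangentAction a x) = x := by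
      intro x
      exact Prod.ext (a.symm_apply_apply x.1) (a.linearIsometryEquiv.symm_apply_apply x.2)
    refine ⟨SE2.inv_mem ha, ?_, ?_⟩
    · nth_rewrite 1 [← ha1]
      rw [Set.image_image]
      simp only [e1, Set.image_id']
    · nth_rewrite 1 [← ha2]
      rw [Set.image_image]
      simp only [e2, Set.image_id']

/-! ## The explicit curvature functions and curves -/

/-- Smooth cutoff function, from `1` (left of `r₁`) to `0` (right of `r₂`). -/
def cutoffDown (r₁ r₂ s : ℝ) : ℝ :=
  if s ≤ r₁ then 1
  else if s < r₂ then
    Real.exp (1 / (s - r₁)) / (Real.exp (1 / (s - r₁)) + Real.exp (1 / (r₂ - s)))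
  else 0

/-- Smooth cutoff function, from `0` (left of `r₁`) to `1` (right of `r₂`). -/
def cutoffUp (r₁ r₂ s : ℝ) : ℝ :=
  if s ≤ r₁ then 0
  else if s < r₂ then
    Real.exp (1 / (r₂ - s)) / (Real.exp (1 / (s - r₁)) + Real.exp (1 / (r₂ - s)))
  else 1

/-- Smooth bump supported on `[r₁, r₂]`. -/
def bump (r₁ r₂ s : ℝ) : ℝ :=
  if s ≤ r₁ then 0
  else if s ≤ (r₁ + r₂) / 2 then cutoffUp r₁ ((r₁ + r₂) / 2) s
  else if s < r₂ then cutoffDown ((r₁ + r₂) / 2) r₂ s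
  else 0

/-- The `L`-periodic function that agrees with `φ` on `[0, L)`. -/
def periodicExtension (L : ℝ) (φ : ℝ → ℝ) (s : ℝ) : ℝ := φ (L * Int.fract (s / L))

def kappa₁ : ℝ → ℝ := periodicExtension 8 fun s =>
  Real.pi / 3 * (bump 0 2 s - 2 * bump 2 4 s + 3 * bump 4 6 s - bump 6 8 s)

def kappa₂ : ℝ → ℝ := periodicExtension 8 fun s =>
  Real.pi / 3 * (bump 0 2 s + 3 * bump 2 4 s - 2 * bump 4 6 s - bump 6 8 s)

def kappa₃ : ℝ → ℝ := periodicExtension 16 fun s =>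
  if s ≤ 8 then kappa₁ s else kappa₂ s

def kappa₄ : ℝ → ℝ := periodicExtension 24 fun s =>
  if s ≤ 8 then kappa₁ s else if s ≤ 16 then kappa₂ s else kappa₁ s

/-- The four curvature functions (indices `0, 1, 2, 3`). -/
def kappa : Fin 4 → ℝ → ℝ := ![kappa₁, kappa₂, kappa₃, kappa₄]

/-- The unit speed curve with curvature `κ` that starts at the origin in direction `(1, 0)`. -/
def curveOf (κ : ℝ → ℝ) (s : ℝ) : Plane :=
  !₂[∫ τ in (0 : ℝ)..s, Real.cos (∫ u in (0 : ℝ)..τ, κ u),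
     ∫ τ in (0 : ℝ)..s, Real.sin (∫ u in (0 : ℝ)..τ, κ u)]

/-- The four curves (indices `0, 1, 2, 3`). -/
def gamma (i : Fin 4) : ℝ → Plane := curveOf (kappa i)

/-- `ρ : I₂ → I₁` is continuous, satisfies `κ₂ = κ₁ ∘ ρ` on `I₂`, and has `ρ' = 1` at every point
of `I₂` that it does not send to (the parameter of) a vertex of the first curve piece.
Surjectivity of `ρ` is not required. -/
def IsCurvatureMatching (γ₁ γ₂ : ℝ → Plane) (I₁ I₂ : Set ℝ) (ρ : ℝ → ℝ) : Prop :=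
  ContinuousOn ρ I₂ ∧ Set.MapsTo ρ I₂ I₁ ∧
    (∀ s ∈ I₂, γ₁ (ρ s) ∉ {p | ∃ t ∈ I₁, γ₁ t = p ∧ curvatureDot γ₁ t = 0} →
      HasDerivWithinAt ρ 1 I₂ s) ∧
    ∀ s ∈ I₂, curvature γ₂ s = curvature γ₁ (ρ s)

end SignatureCurves

end

noncomputable section

namespace SignatureCurves

open Set Filter Topology MeasureTheory

/-! ## The unit bump -/

/-! On each interval $[2n,2n+2]$ every $\kappa_i$ is $\frac{\pi}{3}$ times an integer `height i n`
in $\{1,-2,3,-1\}$ times one fixed bump (`kappa_eq_bumpTrain`). The bump has area 1, so the $n$-th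
arc turns the tangent by exactly $\frac{\pi}{3}$ times its height. All joints have headings in
$\frac{\pi}{3}\mathbb Z$, a block of four arcs turns by $\frac{\pi}{3}$, and 24 arcs turn by $2\pi$.
This reduces almost everything to integer sequences of period 24, which are checked by kernel
computation.

Closing and simplicity. An arc is symmetric about its midpoint, so its chord points along the mean
heading (`arcIntegral_at_two`). Chord displacements in directions $j\frac{\pi}{3}$ are therefore
integer combinations of three numbers $A,B,D$, one for each absolute turn 1, 2, 3. Over 24 arcs
these combinations cancel identically, so the curve closes whatever $A,B,D$ are. Crude bounds on
$A,B,D$ and on the excursion along each arc (`arcRange_holds`) separate non-adjacent arcs in one of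
three directions. Adjacent arcs are separated at their joint by a direction in which one of them
rises strictly, and a single arc advances along its own chord. `height_simpleClosedTrain` is the
resulting certificate. An injective periodic parametrization then embeds a circle, which gives
simplicity in the topological sense.

Congruence and symmetry. A motion that maps one oriented curve onto another lifts to a shift of arc
length (`exists_shift_of_mapsOnto`), so the curvatures agree up to that shift. Zeros of the
curvature are the even integers and the values at odd integers give the heights, so the height
sequences are shifts of each other (`exists_shift_of_bumpTrain`). Conversely a period of the
curvature yields a rigid motion (`rigidMotion_curveOf`). The sequences are not shifts of each other,
and their periods 4, 4, 8, 12 give cyclic groups of order 6, 6, 3, 2. Signatures see only the set of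
heights, and each height occurs six times among the 24 arcs.

Non-matching. Extreme curvature values force $\rho(3)=5$ and $\rho(5)=3$. Unit slope on $(3,4)$
gives $\rho(4)=6$, so on the way from 6 down to 3 the map $\rho$ takes the value 4, where
$\kappa_1=0$, at a point of $(4,5]$, where $\kappa_2<0$. -/

/-- The bump supported on `[0, 2]`, with maximum `1` at `1`. -/
def unitBump (x : ℝ) : ℝ := Real.smoothTransition x * Real.smoothTransition (2 - x)

/-- The library's transition uses $e^{-1/x}$; multiplying numerator and denominator by
$e^{1/x}e^{1/(1-x)}$ produces the form used by the cutoffs. -/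
lemma smoothTransition_of_mem_Ioo {x : ℝ} (h0 : 0 < x) (h1 : x < 1) :
    Real.smoothTransition x
      = Real.exp (1 / (1 - x)) / (Real.exp (1 / x) + Real.exp (1 / (1 - x))) := by
  have h2 : 0 < 1 - x := by linarith
  unfold Real.smoothTransition expNegInvGlue
  rw [if_neg h0.not_ge, if_neg h2.not_ge, Real.exp_neg, Real.exp_neg, one_div, one_div]
  have e1 := Real.exp_pos x⁻¹
  have e2 := Real.exp_pos (1 - x)⁻¹
  field_simp
  ring

/-- Both quotients have the same denominator. This identity is what fixes the area of the bump. -/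
lemma smoothTransition_add_one_sub (x : ℝ) :
    Real.smoothTransition x + Real.smoothTransition (1 - x) = 1 := by
  unfold Real.smoothTransition
  have h := Real.smoothTransition.pos_denom x
  rw [sub_sub_cancel, add_comm (expNegInvGlue (1 - x)), ← add_div, div_self h.ne']

lemma cutoffUp_eq (r s : ℝ) : cutoffUp r (r + 1) s = Real.smoothTransition (s - r) := by
  unfold cutoffUp
  split_ifs with h1 h2
  · rw [Real.smoothTransition.zero_of_nonpos (by linarith)]
  · rw [smoothTransition_of_mem_Ioo (by linarith) (by linarith),
      show 1 - (s - r) = r + 1 - s by ring]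
  · rw [Real.smoothTransition.one_of_one_le (by linarith)]

lemma cutoffDown_eq (r s : ℝ) : cutoffDown r (r + 1) s = Real.smoothTransition (r + 1 - s) := by
  unfold cutoffDown
  split_ifs with h1 h2
  · rw [Real.smoothTransition.one_of_one_le (by linarith)]
  · rw [smoothTransition_of_mem_Ioo (by linarith) (by linarith),
      show 1 - (r + 1 - s) = s - r by ring, add_comm]
  · rw [Real.smoothTransition.zero_of_nonpos (by linarith)]

/-- Length 2 makes each half a transition of length 1; on either half the other factor of the
product is constantly 1, so no case distinction survives. -/
lemma bump_eq {r₁ r₂ : ℝ} (h : r₂ = r₁ + 2) (s : ℝ) : bump r₁ r₂ s = unitBump (s - r₁) := by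
  subst h
  unfold bump unitBump
  rw [show (r₁ + (r₁ + 2)) / 2 = r₁ + 1 by ring, show r₁ + 2 = (r₁ + 1) + 1 by ring,
    cutoffUp_eq, cutoffDown_eq, show 2 - (s - r₁) = r₁ + 1 + 1 - s by ring]
  split_ifs with h1 h2 h3
  · rw [Real.smoothTransition.zero_of_nonpos (by linarith), zero_mul]
  · rw [Real.smoothTransition.one_of_one_le (x := r₁ + 1 + 1 - s) (by linarith), mul_one]
  · rw [Real.smoothTransition.one_of_one_le (x := s - r₁) (by linarith), one_mul]
  · rw [Real.smoothTransition.zero_of_nonpos (x := r₁ + 1 + 1 - s) (by linarith), mul_zero]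

lemma contDiff_unitBump : ContDiff ℝ ∞ unitBump :=
  Real.smoothTransition.contDiff.mul (Real.smoothTransition.contDiff.comp
    (contDiff_const.sub contDiff_id))

lemma continuous_unitBump : Continuous unitBump := contDiff_unitBump.continuous

lemma differentiable_unitBump : Differentiable ℝ unitBump :=
  contDiff_unitBump.differentiable (by simp)

lemma unitBump_nonneg (x : ℝ) : 0 ≤ unitBump x :=
  mul_nonneg (Real.smoothTransition.nonneg _) (Real.smoothTransition.nonneg _)

lemma unitBump_le_one (x : ℝ) : unitBump x ≤ 1 :=
  mul_le_one₀ (Real.smoothTransition.le_one _) (Real.smoothTransition.nonneg _)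
    (Real.smoothTransition.le_one _)

lemma unitBump_two_sub (x : ℝ) : unitBump (2 - x) = unitBump x := by
  unfold unitBump
  rw [sub_sub_cancel, mul_comm]

lemma unitBump_of_le_one {x : ℝ} (h : x ≤ 1) : unitBump x = Real.smoothTransition x := by
  unfold unitBump
  rw [Real.smoothTransition.one_of_one_le (x := 2 - x) (by linarith), mul_one]

lemma unitBump_eq_zero_iff {x : ℝ} : unitBump x = 0 ↔ x ≤ 0 ∨ 2 ≤ x := by
  unfold unitBump
  rw [mul_eq_zero, Real.smoothTransition.zero_iff_nonpos, Real.smoothTransition.zero_iff_nonpos]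
  constructor <;> rintro (h | h) <;> [left; right; left; right] <;> linarith

lemma unitBump_of_nonpos {x : ℝ} (h : x ≤ 0) : unitBump x = 0 := unitBump_eq_zero_iff.2 (.inl h)

lemma unitBump_of_two_le {x : ℝ} (h : 2 ≤ x) : unitBump x = 0 := unitBump_eq_zero_iff.2 (.inr h)

lemma unitBump_pos {x : ℝ} (h0 : 0 < x) (h2 : x < 2) : 0 < unitBump x :=
  mul_pos (Real.smoothTransition.pos_of_pos h0) (Real.smoothTransition.pos_of_pos (by linarith))

lemma unitBump_one : unitBump 1 = 1 := by
  rw [unitBump_of_le_one le_rfl, Real.smoothTransition.one]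

lemma eq_one_of_unitBump_eq_one {x : ℝ} (h : unitBump x = 1) : x = 1 := by
  rcases lt_trichotomy x 1 with h1 | h1 | h1
  · rw [unitBump_of_le_one h1.le] at h
    exact absurd h (Real.smoothTransition.lt_one_of_lt_one h1).ne
  · exact h1
  · rw [← unitBump_two_sub, unitBump_of_le_one (by linarith)] at h
    exact absurd h (Real.smoothTransition.lt_one_of_lt_one (by linarith)).ne

lemma hasDerivAt_expNegInvGlue {x : ℝ} (hx : 0 < x) :
    HasDerivAt expNegInvGlue (Real.exp (-x⁻¹) * (x ^ 2)⁻¹) x := by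
  have h : expNegInvGlue =ᶠ[𝓝 x] fun y => Real.exp (-y⁻¹) := by
    filter_upwards [lt_mem_nhds hx] with y hy
    simp [expNegInvGlue, hy.not_ge]
  refine HasDerivAt.congr_of_eventuallyEq ?_ h
  have h2 := ((hasDerivAt_inv hx.ne').neg).exp
  rwa [neg_neg] at h2

lemma deriv_smoothTransition_pos {x : ℝ} (h0 : 0 < x) (h1 : x < 1) :
    0 < deriv Real.smoothTransition x := by
  have h2 : 0 < 1 - x := by linarith
  have d1 := hasDerivAt_expNegInvGlue h0
  have d2 : HasDerivAt (fun y : ℝ => expNegInvGlue (1 - y)) _ x :=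
    (hasDerivAt_expNegInvGlue h2).scomp x ((hasDerivAt_id x).const_sub 1)
  have d3 := d1.div (d1.add d2) (Real.smoothTransition.pos_denom x).ne'
  have e : deriv Real.smoothTransition x = _ := d3.deriv
  rw [e]
  have p1 := expNegInvGlue.pos_of_pos h0
  have p2 := expNegInvGlue.pos_of_pos h2
  have p3 := Real.exp_pos (-x⁻¹)
  have p4 := Real.exp_pos (-(1 - x)⁻¹)
  apply div_pos
  · simp only [smul_eq_mul, Pi.add_apply]
    have q1 : 0 < Real.exp (-x⁻¹) * (x ^ 2)⁻¹ := by positivity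
    have q2 : 0 < Real.exp (-(1 - x)⁻¹) * ((1 - x) ^ 2)⁻¹ := by positivity
    nlinarith [mul_pos q1 p2, mul_pos q2 p1]
  · simp only [Pi.add_apply]
    positivity

lemma deriv_unitBump_two_sub (x : ℝ) : deriv unitBump (2 - x) = -deriv unitBump x := by
  have h : unitBump = fun y => unitBump (2 - y) := funext fun y => (unitBump_two_sub y).symm
  conv_rhs => rw [h, deriv_comp_const_sub]
  rw [neg_neg]

lemma deriv_unitBump_eq_zero_of_eq_zero {x : ℝ} (h : unitBump x = 0) : deriv unitBump x = 0 :=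
  IsLocalMin.deriv_eq_zero (Eventually.of_forall fun y => by rw [h]; exact unitBump_nonneg y)

lemma deriv_unitBump_pos {x : ℝ} (h0 : 0 < x) (h1 : x < 1) : 0 < deriv unitBump x := by
  have h : unitBump =ᶠ[𝓝 x] Real.smoothTransition := by
    filter_upwards [gt_mem_nhds h1] with y hy using unitBump_of_le_one hy.le
  rw [h.deriv_eq]
  exact deriv_smoothTransition_pos h0 h1

lemma deriv_unitBump_eq_zero_iff {x : ℝ} (h0 : 0 ≤ x) (h2 : x ≤ 2) :
    deriv unitBump x = 0 ↔ x = 0 ∨ x = 1 ∨ x = 2 := by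
  constructor
  · intro h
    by_contra! hx
    obtain ⟨h3, h4, h5⟩ := hx
    rcases lt_or_gt_of_ne h4 with h6 | h6
    · exact (deriv_unitBump_pos (lt_of_le_of_ne h0 h3.symm) h6).ne' h
    · have h7 := deriv_unitBump_pos (x := 2 - x)
        (by linarith [lt_of_le_of_ne h2 h5]) (by linarith)
      rw [deriv_unitBump_two_sub, h, neg_zero] at h7
      exact lt_irrefl _ h7
  · rintro (rfl | rfl | rfl)
    · exact deriv_unitBump_eq_zero_of_eq_zero (unitBump_of_nonpos le_rfl)
    · exact IsLocalMax.deriv_eq_zero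
        (Eventually.of_forall fun y => by rw [unitBump_one]; exact unitBump_le_one y)
    · exact deriv_unitBump_eq_zero_of_eq_zero (unitBump_of_two_le le_rfl)

/-! ## The primitive of the unit bump -/

/-- The primitive of the unit bump that vanishes at `0`. -/
def bumpPrimitive (x : ℝ) : ℝ := ∫ t in (0 : ℝ)..x, unitBump t

lemma intervalIntegrable_unitBump (a b : ℝ) : IntervalIntegrable unitBump volume a b :=
  continuous_unitBump.intervalIntegrable a b

lemma hasDerivAt_bumpPrimitive (x : ℝ) : HasDerivAt bumpPrimitive (unitBump x) x :=
  intervalIntegral.integral_hasDerivAt_right (intervalIntegrable_unitBump 0 x)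
    (continuous_unitBump.stronglyMeasurableAtFilter _ _) continuous_unitBump.continuousAt

lemma continuous_bumpPrimitive : Continuous bumpPrimitive :=
  continuous_iff_continuousAt.2 fun x => (hasDerivAt_bumpPrimitive x).continuousAt

@[simp] lemma bumpPrimitive_zero : bumpPrimitive 0 = 0 := intervalIntegral.integral_same

/-- Pairing $t$ with $1-t$ on the rising half gives twice the area equal to 1. -/
lemma bumpPrimitive_one : bumpPrimitive 1 = 1 / 2 := by
  have h1 : bumpPrimitive 1 = ∫ t in (0 : ℝ)..1, Real.smoothTransition t := by
    refine intervalIntegral.integral_congr fun t ht => ?_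
    rw [uIcc_of_le zero_le_one] at ht
    exact unitBump_of_le_one ht.2
  have h2 : ∫ t in (0 : ℝ)..1, Real.smoothTransition (1 - t)
      = ∫ t in (0 : ℝ)..1, Real.smoothTransition t := by
    rw [intervalIntegral.integral_comp_sub_left (fun t => Real.smoothTransition t)]
    simp
  have h3 : ∫ t in (0 : ℝ)..1, (Real.smoothTransition t + Real.smoothTransition (1 - t)) = 1 := by
    simp [smoothTransition_add_one_sub]
  have c := Real.smoothTransition.continuous
  have c2 : Continuous fun t : ℝ => Real.smoothTransition (1 - t) := by fun_prop
  rw [intervalIntegral.integral_add (c.intervalIntegrable _ _) (c2.intervalIntegrable _ _),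
    h2] at h3
  rw [h1]
  linarith

lemma bumpPrimitive_sub (a b : ℝ) :
    bumpPrimitive b - bumpPrimitive a = ∫ t in a..b, unitBump t :=
  intervalIntegral.integral_interval_sub_left (intervalIntegrable_unitBump _ _)
    (intervalIntegrable_unitBump _ _)

lemma bumpPrimitive_two_sub (x : ℝ) : bumpPrimitive (2 - x) = 1 - bumpPrimitive x := by
  have h : ∀ y, bumpPrimitive (2 - y) = bumpPrimitive 2 - bumpPrimitive y := by
    intro y
    have h1 := intervalIntegral.integral_comp_sub_left (a := 0) (b := y) unitBump 2
    simp only [unitBump_two_sub, sub_zero] at h1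
    rw [← bumpPrimitive_sub (2 - y) 2] at h1
    change bumpPrimitive y = _ at h1
    linarith
  -- The fixed point of the reflection $x\mapsto 2-x$ determines the total area.
  have h1 := h 1
  rw [show (2 : ℝ) - 1 = 1 by norm_num, bumpPrimitive_one] at h1
  rw [h]
  linarith

lemma bumpPrimitive_two : bumpPrimitive 2 = 1 := by
  have h := bumpPrimitive_two_sub 0
  simpa using h

lemma monotone_bumpPrimitive : Monotone bumpPrimitive :=
  monotone_of_hasDerivAt_nonneg hasDerivAt_bumpPrimitive unitBump_nonneg

lemma strictMonoOn_bumpPrimitive : StrictMonoOn bumpPrimitive (Icc 0 2) := by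
  refine strictMonoOn_of_deriv_pos (convex_Icc 0 2) continuous_bumpPrimitive.continuousOn ?_
  intro x hx
  rw [interior_Icc] at hx
  rw [(hasDerivAt_bumpPrimitive x).deriv]
  exact unitBump_pos hx.1 hx.2

lemma bumpPrimitive_nonneg {x : ℝ} (h : 0 ≤ x) : 0 ≤ bumpPrimitive x := by
  simpa using monotone_bumpPrimitive h

lemma bumpPrimitive_le_one {x : ℝ} (h : x ≤ 2) : bumpPrimitive x ≤ 1 := by
  simpa [bumpPrimitive_two] using monotone_bumpPrimitive h

/-- The slope is at most 1 and the value at 1 is $\frac12$. This converts a known amount of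
remaining turn into a bound on the remaining arc length. -/
lemma sub_half_le_bumpPrimitive {x : ℝ} (h : x ≤ 1) : x - 1 / 2 ≤ bumpPrimitive x := by
  have h1 := bumpPrimitive_sub x 1
  have h2 : ∫ t in x..1, unitBump t ≤ ∫ t in x..1, (1 : ℝ) :=
    intervalIntegral.integral_mono_on h (intervalIntegrable_unitBump _ _)
      (by simp) fun t _ => unitBump_le_one t
  rw [intervalIntegral.integral_const, smul_eq_mul, mul_one] at h2
  rw [bumpPrimitive_one] at h1
  linarith

/-! ## Displacement along an arc -/

/-- Displacement in direction `j π / 3` along an arc that starts with heading `0` and turns by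
`k π / 3`, as a function of arc length. -/
def arcIntegral (k j : ℤ) (x : ℝ) : ℝ :=
  ∫ t in (0 : ℝ)..x, Real.cos (Real.pi / 3 * (k * bumpPrimitive t - j))

lemma continuous_arcIntegrand (k j : ℤ) :
    Continuous fun t => Real.cos (Real.pi / 3 * (k * bumpPrimitive t - j)) := by
  have := continuous_bumpPrimitive
  fun_prop

lemma arcIntegral_neg (k j : ℤ) (x : ℝ) : arcIntegral (-k) (-j) x = arcIntegral k j x := by
  unfold arcIntegral
  congr 1
  funext t
  rw [← Real.cos_neg]
  congr 1
  push_cast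
  ring

lemma arcIntegral_add_three (k j : ℤ) (x : ℝ) :
    arcIntegral k (j + 3) x = -arcIntegral k j x := by
  unfold arcIntegral
  rw [← intervalIntegral.integral_neg]
  congr 1
  funext t
  rw [← Real.cos_sub_pi]
  congr 1
  push_cast
  ring

lemma arcIntegral_add_six_mul (k j : ℤ) (m : ℤ) (x : ℝ) :
    arcIntegral k (j + 6 * m) x = arcIntegral k j x := by
  unfold arcIntegral
  congr 1
  funext t
  rw [← Real.cos_add_int_mul_two_pi _ m]
  congr 1
  push_cast
  ring

lemma arcIntegral_emod_six (k j : ℤ) (x : ℝ) : arcIntegral k (j % 6) x = arcIntegral k j x := by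
  rw [← arcIntegral_add_six_mul k (j % 6) (j / 6), Int.emod_add_mul_ediv]

/-- Traversed backwards, the arc is its own mirror image: `bumpPrimitive` is antisymmetric about the
midpoint, so the heading $kP$ becomes $k-kP$ and direction $j$ becomes $k-j$. -/
lemma arcIntegral_two_sub (k j : ℤ) (x : ℝ) :
    arcIntegral k j 2 - arcIntegral k j (2 - x) = arcIntegral k (k - j) x := by
  have c := continuous_arcIntegrand k j
  unfold arcIntegral
  rw [intervalIntegral.integral_interval_sub_left (c.intervalIntegrable _ _)
    (c.intervalIntegrable _ _)]
  have h := intervalIntegral.integral_comp_sub_left (a := 0) (b := x)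
    (fun t => Real.cos (Real.pi / 3 * (k * bumpPrimitive t - j))) 2
  rw [sub_zero] at h
  rw [← h]
  congr 1
  funext t
  rw [bumpPrimitive_two_sub, ← Real.cos_neg]
  congr 1
  push_cast
  ring

/-- Length of the chord of an arc of length `2` that turns by `k π / 3`. -/
def chordLength (k : ℤ) : ℝ :=
  ∫ t in (0 : ℝ)..2, Real.cos (Real.pi / 3 * (k * (bumpPrimitive t - 1 / 2)))

/-- Relative to the mean heading $k\frac{\pi}{6}$ the transverse component is odd about the midpoint
and integrates to 0, so the chord points exactly along the mean heading. -/
lemma arcIntegral_at_two (k j : ℤ) :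
    arcIntegral k j 2 = Real.cos (Real.pi / 3 * (k / 2 - j)) * chordLength k := by
  have hP := continuous_bumpPrimitive
  set f : ℝ → ℝ := fun t => Real.cos (Real.pi / 3 * (k * (bumpPrimitive t - 1 / 2))) with hf
  set g : ℝ → ℝ := fun t => Real.sin (Real.pi / 3 * (k * (bumpPrimitive t - 1 / 2))) with hg
  have cf : Continuous f := by fun_prop
  have cg : Continuous g := by fun_prop
  have h0 : ∫ t in (0 : ℝ)..2, g t = 0 := by
    have h := intervalIntegral.integral_comp_sub_left (a := 0) (b := 2) g 2
    have h1 : (fun t => g (2 - t)) = fun t => -g t := by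
      funext t
      simp only [hg]
      rw [bumpPrimitive_two_sub, ← Real.sin_neg]
      congr 1
      ring
    rw [h1, intervalIntegral.integral_neg, sub_self, sub_zero] at h
    linarith
  have h1 : arcIntegral k j 2 = ∫ t in (0 : ℝ)..2,
      (Real.cos (Real.pi / 3 * (k / 2 - j)) * f t
        - Real.sin (Real.pi / 3 * (k / 2 - j)) * g t) := by
    unfold arcIntegral
    congr 1
    funext t
    rw [← Real.cos_add]
    congr 1
    ring
  rw [h1, intervalIntegral.integral_sub ((cf.const_mul _).intervalIntegrable _ _)
    ((cg.const_mul _).intervalIntegrable _ _), intervalIntegral.integral_const_mul,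
    intervalIntegral.integral_const_mul, h0, mul_zero, sub_zero]
  rfl

/-- The primitive rises up to $p$ and falls afterwards, so its minimum is at an endpoint and its
maximum at $p$; the fall costs at most $\delta$ per unit length. -/
lemma integral_mem_Icc_of_unimodal {f : ℝ → ℝ} (hf : Continuous f) {p δ : ℝ}
    (hp2 : p ≤ 2) (hδ : 0 ≤ δ) (h1 : ∀ t, 0 ≤ t → t ≤ p → 0 ≤ f t)
    (h2 : ∀ t, p ≤ t → t ≤ 2 → f t ≤ 0 ∧ -δ ≤ f t) (hE : 0 ≤ ∫ t in (0 : ℝ)..2, f t)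
    {x : ℝ} (hx0 : 0 ≤ x) (hx2 : x ≤ 2) :
    0 ≤ ∫ t in (0 : ℝ)..x, f t ∧
      ∫ t in (0 : ℝ)..x, f t ≤ (∫ t in (0 : ℝ)..2, f t) + δ * (2 - p) := by
  have ii : ∀ a b, IntervalIntegrable f volume a b := fun a b => hf.intervalIntegrable a b
  have lower : ∀ a b, p ≤ a → a ≤ b → b ≤ 2 → -δ * (b - a) ≤ ∫ t in a..b, f t := by
    intro a b ha hab hb
    have h := intervalIntegral.integral_mono_on hab
      (intervalIntegrable_const (c := -δ)) (ii a b)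
      fun t ht => (h2 t (ha.trans ht.1) (ht.2.trans hb)).2
    rw [intervalIntegral.integral_const, smul_eq_mul] at h
    linarith
  rcases le_total x p with hxp | hxp
  · have e1 : 0 ≤ ∫ t in (0 : ℝ)..x, f t :=
      intervalIntegral.integral_nonneg hx0 fun t ht => h1 t ht.1 (ht.2.trans hxp)
    have e2 : 0 ≤ ∫ t in x..p, f t :=
      intervalIntegral.integral_nonneg hxp fun t ht => h1 t (hx0.trans ht.1) ht.2
    have e3 := lower p 2 le_rfl hp2 le_rfl
    have e4 := intervalIntegral.integral_add_adjacent_intervals (ii 0 x) (ii x p)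
    have e5 := intervalIntegral.integral_add_adjacent_intervals (ii 0 p) (ii p 2)
    exact ⟨e1, by linarith⟩
  · have e1 := intervalIntegral.integral_add_adjacent_intervals (ii 0 x) (ii x 2)
    have e2 := lower x 2 hxp hx2 le_rfl
    have e3 : 0 ≤ ∫ t in x..2, -f t :=
      intervalIntegral.integral_nonneg hx2 fun t ht =>
        neg_nonneg.2 (h2 t (hxp.trans ht.1) ht.2).1
    rw [intervalIntegral.integral_neg] at e3
    have e4 : δ * (2 - x) ≤ δ * (2 - p) := mul_le_mul_of_nonneg_left (by linarith) hδ
    exact ⟨by linarith, by linarith⟩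

lemma arcIntegral_mem_Icc {k j : ℤ} {a δ : ℝ} (ha1 : 1 / 2 ≤ a) (ha2 : a ≤ 1) (hδ : 0 ≤ δ)
    (h1 : ∀ u : ℝ, 0 ≤ u → u ≤ a → 0 ≤ Real.cos (Real.pi / 3 * (k * u - j)))
    (h2 : ∀ u : ℝ, a ≤ u → u ≤ 1 → Real.cos (Real.pi / 3 * (k * u - j)) ≤ 0 ∧
      -δ ≤ Real.cos (Real.pi / 3 * (k * u - j)))
    (hE : 0 ≤ arcIntegral k j 2) {x : ℝ} (hx0 : 0 ≤ x) (hx2 : x ≤ 2) :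
    0 ≤ arcIntegral k j x ∧ arcIntegral k j x ≤ arcIntegral k j 2 + δ * (3 / 2 - a) := by
  have hmem : a ∈ Icc (bumpPrimitive 1) (bumpPrimitive 2) := by
    rw [bumpPrimitive_one, bumpPrimitive_two]
    exact ⟨ha1, ha2⟩
  obtain ⟨p, hp, rfl⟩ := intermediate_value_Icc (by norm_num : (1 : ℝ) ≤ 2)
    continuous_bumpPrimitive.continuousOn hmem
  have h := integral_mem_Icc_of_unimodal (continuous_arcIntegrand k j) (p := p) (δ := δ)
    hp.2 hδ
    (fun t ht0 htp => h1 _ (bumpPrimitive_nonneg ht0) (monotone_bumpPrimitive htp))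
    (fun t htp ht2 => h2 _ (monotone_bumpPrimitive htp) (bumpPrimitive_le_one ht2)) hE hx0 hx2
  refine ⟨h.1, h.2.trans ?_⟩
  -- With $P$ = `bumpPrimitive` and $a=P(p)$, this reads $(2-p)-\frac12\le P(2-p)=1-a$. Since
  -- $a\ge\frac12$, the point $p$ lies in $[1,2]$, where the bound applies.
  have h3 := sub_half_le_bumpPrimitive (x := 2 - p) (by linarith [hp.1])
  rw [bumpPrimitive_two_sub] at h3
  have h4 : δ * (2 - p) ≤ δ * (3 / 2 - bumpPrimitive p) :=
    mul_le_mul_of_nonneg_left (by linarith) hδ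
  unfold arcIntegral at h4 ⊢
  linarith

/-! ## Bounds for the chords -/

lemma chordLength_le_two (k : ℤ) : chordLength k ≤ 2 := by
  have hP := continuous_bumpPrimitive
  have h := intervalIntegral.integral_mono_on (μ := volume) (zero_le_two (α := ℝ))
    (Continuous.intervalIntegrable (by fun_prop :
      Continuous fun t => Real.cos (Real.pi / 3 * (k * (bumpPrimitive t - 1 / 2)))) 0 2)
    (intervalIntegrable_const (c := (1 : ℝ))) fun t _ => Real.cos_le_one _
  rw [intervalIntegral.integral_const, smul_eq_mul] at h
  unfold chordLength
  linarith

lemma le_chordLength {k : ℤ} {c : ℝ}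
    (h : ∀ u : ℝ, 0 ≤ u → u ≤ 1 → c ≤ Real.cos (Real.pi / 3 * (k * (u - 1 / 2)))) :
    2 * c ≤ chordLength k := by
  have hP := continuous_bumpPrimitive
  have h := intervalIntegral.integral_mono_on (μ := volume) (zero_le_two (α := ℝ))
    (intervalIntegrable_const (c := c))
    (Continuous.intervalIntegrable (by fun_prop :
      Continuous fun t => Real.cos (Real.pi / 3 * (k * (bumpPrimitive t - 1 / 2)))) 0 2)
    fun t ht => h _ (bumpPrimitive_nonneg ht.1) (bumpPrimitive_le_one ht.2)
  rw [intervalIntegral.integral_const, smul_eq_mul] at h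
  unfold chordLength
  linarith

lemma cos_le_cos_of_abs_le {x y : ℝ} (hy : y ≤ Real.pi) (h : |x| ≤ y) :
    Real.cos y ≤ Real.cos x := by
  rw [← Real.cos_abs x]
  exact Real.cos_le_cos_of_nonneg_of_le_pi (abs_nonneg x) hy h

lemma sqrt_three_le_chordLength_one : √3 ≤ chordLength 1 := by
  have h := le_chordLength (k := 1) (c := √3 / 2) fun u h0 h1 => by
    refine Real.cos_pi_div_six.ge.trans ?_
    have := Real.pi_pos
    apply cos_le_cos_of_abs_le (by linarith)
    rw [abs_le]
    push_cast
    constructor <;> nlinarith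
  linarith

lemma one_le_chordLength_two : 1 ≤ chordLength 2 := by
  have h := le_chordLength (k := 2) (c := 1 / 2) fun u h0 h1 => by
    refine Real.cos_pi_div_three.ge.trans ?_
    have := Real.pi_pos
    apply cos_le_cos_of_abs_le (by linarith)
    rw [abs_le]
    push_cast
    constructor <;> nlinarith
  linarith

/-- A half-turn has heading up to $\pm\frac{\pi}{2}$ from its chord, so a pointwise bound gives only
0. Instead the integrand is $\sin(\pi P)$, with $P$ = `bumpPrimitive`, and Jordan's inequality
yields $\sin(\pi P)\ge 2P\ge 2t-1$ on $[\frac12,1]$. That contributes $\frac14$, doubled by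
symmetry. -/
lemma half_le_chordLength_three : 1 / 2 ≤ chordLength 3 := by
  have hP := continuous_bumpPrimitive
  have hpi := Real.pi_pos
  set f : ℝ → ℝ := fun t => Real.cos (Real.pi / 3 * ((3 : ℤ) * (bumpPrimitive t - 1 / 2))) with hf
  have ef : ∀ t, f t = Real.sin (Real.pi * bumpPrimitive t) := by
    intro t
    simp only [hf]
    rw [← Real.cos_sub_pi_div_two]
    congr 1
    push_cast
    ring
  have cf : Continuous f := by fun_prop
  have ii : ∀ a b, IntervalIntegrable f volume a b := fun a b => cf.intervalIntegrable a b
  have sym : ∀ t, f (2 - t) = f t := by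
    intro t
    rw [ef, ef, bumpPrimitive_two_sub, mul_sub, mul_one, Real.sin_pi_sub]
  have half : ∫ t in (1 : ℝ)..2, f t = ∫ t in (0 : ℝ)..1, f t := by
    have h := intervalIntegral.integral_comp_sub_left (a := 0) (b := 1) f 2
    simp only [sym] at h
    rw [h]
    norm_num
  have pos : 0 ≤ ∫ t in (0 : ℝ)..(1 / 2), f t := by
    refine intervalIntegral.integral_nonneg (by norm_num) fun t ht => ?_
    rw [ef]
    have h1 := bumpPrimitive_nonneg ht.1
    have h2 := bumpPrimitive_le_one (x := t) (by linarith [ht.2])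
    exact Real.sin_nonneg_of_nonneg_of_le_pi (by positivity) (by nlinarith)
  have low : ∫ t in (1 / 2 : ℝ)..1, (2 * t - 1) ≤ ∫ t in (1 / 2 : ℝ)..1, f t := by
    refine intervalIntegral.integral_mono_on (by norm_num)
      (Continuous.intervalIntegrable (by fun_prop) _ _) (ii _ _) fun t ht => ?_
    rw [ef]
    have h1 := bumpPrimitive_nonneg (x := t) (by linarith [ht.1])
    have h2 := monotone_bumpPrimitive ht.2
    rw [bumpPrimitive_one] at h2
    have h3 := Real.mul_le_sin (x := Real.pi * bumpPrimitive t) (by positivity) (by nlinarith)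
    have h4 := sub_half_le_bumpPrimitive ht.2
    have h5 : 2 / Real.pi * (Real.pi * bumpPrimitive t) = 2 * bumpPrimitive t := by field_simp
    linarith
  have comp : ∫ t in (1 / 2 : ℝ)..1, (2 * t - 1) = 1 / 4 := by
    rw [intervalIntegral.integral_sub (Continuous.intervalIntegrable (by fun_prop) _ _)
      (Continuous.intervalIntegrable (by fun_prop) _ _), intervalIntegral.integral_const_mul,
      integral_id]
    norm_num
  have e1 := intervalIntegral.integral_add_adjacent_intervals (ii 0 (1 / 2)) (ii (1 / 2) 1)
  have e2 := intervalIntegral.integral_add_adjacent_intervals (ii 0 1) (ii 1 2)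
  change 1 / 2 ≤ ∫ t in (0 : ℝ)..2, f t
  linarith

/-! ## Linear forms in the chord displacements -/

/-- Linear forms `a A + b B + d D + e / 24` in the basic chord displacements `A`, `B`, `D`. -/
abbrev LinForm := ℤ × ℤ × ℤ × ℤ

/-- Value of a linear form at the basic chord displacements. -/
def LinForm.eval (f : LinForm) : ℝ :=
  f.1 * arcIntegral 1 0 2 + f.2.1 * arcIntegral 2 0 2 + f.2.2.1 * arcIntegral 3 1 2
    + f.2.2.2 / 24

lemma LinForm.eval_zero : LinForm.eval 0 = 0 := by simp [LinForm.eval]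

lemma LinForm.eval_add (f g : LinForm) : (f + g).eval = f.eval + g.eval := by
  simp only [LinForm.eval, Prod.fst_add, Prod.snd_add]
  push_cast
  ring

lemma LinForm.eval_neg (f : LinForm) : (-f).eval = -f.eval := by
  simp only [LinForm.eval, Prod.fst_neg, Prod.snd_neg]
  push_cast
  ring

lemma LinForm.eval_sub (f g : LinForm) : (f - g).eval = f.eval - g.eval := by
  rw [sub_eq_add_neg, LinForm.eval_add, LinForm.eval_neg, sub_eq_add_neg]

/-- Lower bound for `24` times the value of a linear form. -/
def LinForm.lower (f : LinForm) : ℤ :=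
  f.1 * (if 0 ≤ f.1 then 36 else 42) + f.2.1 * (if 0 ≤ f.2.1 then 12 else 24)
    + f.2.2.1 * (if 0 ≤ f.2.2.1 then 10 else 42) + f.2.2.2

lemma mul_ite_le {a : ℤ} {l u : ℤ} {x : ℝ} (hl : l ≤ 24 * x) (hu : 24 * x ≤ u) :
    ((a * (if 0 ≤ a then l else u) : ℤ) : ℝ) ≤ 24 * (a * x) := by
  push_cast
  split_ifs with h
  · have h' : (0 : ℝ) ≤ a := by exact_mod_cast h
    nlinarith
  · have h' : (a : ℝ) ≤ 0 := by exact_mod_cast (not_le.1 h).le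
    nlinarith

lemma chord_one_zero : arcIntegral 1 0 2 = √3 / 2 * chordLength 1 := by
  rw [arcIntegral_at_two, ← Real.cos_pi_div_six]
  congr 2
  push_cast
  ring

lemma chord_two_zero : arcIntegral 2 0 2 = 1 / 2 * chordLength 2 := by
  rw [arcIntegral_at_two, ← Real.cos_pi_div_three]
  congr 2
  push_cast
  ring

lemma chord_three_one : arcIntegral 3 1 2 = √3 / 2 * chordLength 3 := by
  rw [arcIntegral_at_two, ← Real.cos_pi_div_six]
  congr 2
  push_cast
  ring

lemma LinForm.lower_le (f : LinForm) : (f.lower : ℝ) ≤ 24 * f.eval := by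
  have s0 := Real.sqrt_nonneg 3
  have s1 : √3 * √3 = 3 := Real.mul_self_sqrt (by norm_num)
  -- Chord lengths in $[\sqrt3,2]$, $[1,2]$, $[\frac12,2]$ and $\frac53\le\sqrt3\le\frac74$ put
  -- $24A$, $24B$, $24D$ in $[36,42]$, $[12,24]$, $[10,42]$. Those are the constants in
  -- `LinForm.lower`.
  have s2 : √3 ≤ 7 / 4 := by
    rw [Real.sqrt_le_left (by norm_num)]
    norm_num
  have s3 : 5 / 3 ≤ √3 := Real.le_sqrt_of_sq_le (by norm_num)
  have h1 := mul_ite_le (a := f.1) (l := 36) (u := 42) (x := arcIntegral 1 0 2)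
    (by rw [chord_one_zero]; push_cast; nlinarith [sqrt_three_le_chordLength_one])
    (by rw [chord_one_zero]; push_cast; nlinarith [chordLength_le_two 1])
  have h2 := mul_ite_le (a := f.2.1) (l := 12) (u := 24) (x := arcIntegral 2 0 2)
    (by rw [chord_two_zero]; push_cast; linarith [one_le_chordLength_two])
    (by rw [chord_two_zero]; push_cast; linarith [chordLength_le_two 2])
  have h3 := mul_ite_le (a := f.2.2.1) (l := 10) (u := 42) (x := arcIntegral 3 1 2)
    (by rw [chord_three_one]; push_cast; nlinarith [half_le_chordLength_three])
    (by rw [chord_three_one]; push_cast; nlinarith [chordLength_le_two 3])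
  unfold LinForm.lower LinForm.eval
  push_cast at h1 h2 h3 ⊢
  linarith

lemma LinForm.eval_pos {f : LinForm} (h : 0 < f.lower) : 0 < f.eval := by
  have h1 := f.lower_le
  have h2 : (0 : ℝ) < f.lower := by exact_mod_cast h
  linarith

/-! ## Ranges of the displacement along an arc -/

/-- Bounds (`lo`, `hi`) for a displacement along an arc, and its value (`net`) at the end. -/
structure ArcRange where
  /-- lower bound along the arc -/
  lo : LinForm
  /-- upper bound along the arc -/
  hi : LinForm
  /-- value at the end of the arc -/
  net : LinForm

/-- The bounds for the opposite direction. -/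
def ArcRange.opposite (R : ArcRange) : ArcRange := ⟨-R.hi, -R.lo, -R.net⟩

/-- Bounds for an arc of turn `k ∈ {1, 2, 3}` in direction `j ∈ {0, 1, 2}`. -/
def baseRange (k j : ℤ) : ArcRange :=
  if k = 1 then
    if j = 2 then ⟨(0, 0, 0, -12), 0, 0⟩ else ⟨0, (1, 0, 0, 0), (1, 0, 0, 0)⟩
  else if k = 2 then
    if j = 0 then ⟨0, (0, 1, 0, 9), (0, 1, 0, 0)⟩
    else if j = 1 then ⟨0, (0, 2, 0, 0), (0, 2, 0, 0)⟩
    else ⟨(0, 0, 0, -9), (0, 1, 0, 0), (0, 1, 0, 0)⟩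
  else
    if j = 0 then ⟨0, (0, 0, 0, 24), 0⟩
    else if j = 1 then ⟨0, (0, 0, 1, 8), (0, 0, 1, 0)⟩
    else ⟨(0, 0, 0, -8), (0, 0, 1, 0), (0, 0, 1, 0)⟩

/-- Bounds for an arc of turn `k ∈ {1, 2, 3}` in any direction. -/
def posRange (k j : ℤ) : ArcRange :=
  if j % 6 < 3 then baseRange k (j % 6) else (baseRange k (j % 6 - 3)).opposite

/-- Bounds for an arc of turn `k` with `|k| ∈ {1, 2, 3}` in any direction. -/
def arcRange (k j : ℤ) : ArcRange := if k < 0 then posRange (-k) (-j) else posRange k j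

/-- The bounds `R` are correct for the arc of turn `k` in direction `j`. -/
def ArcRange.Holds (R : ArcRange) (k j : ℤ) : Prop :=
  R.net.eval = arcIntegral k j 2 ∧
    ∀ x, 0 ≤ x → x ≤ 2 → R.lo.eval ≤ arcIntegral k j x ∧ arcIntegral k j x ≤ R.hi.eval

lemma cos_third_nonneg {v : ℝ} (h1 : -(3 / 2) ≤ v) (h2 : v ≤ 3 / 2) :
    0 ≤ Real.cos (Real.pi / 3 * v) := by
  have := Real.pi_pos
  exact Real.cos_nonneg_of_neg_pi_div_two_le_of_le (by nlinarith) (by nlinarith)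

lemma cos_third_pos {v : ℝ} (h1 : -(3 / 2) < v) (h2 : v < 3 / 2) :
    0 < Real.cos (Real.pi / 3 * v) := by
  have := Real.pi_pos
  exact Real.cos_pos_of_mem_Ioo ⟨by nlinarith, by nlinarith⟩

lemma cos_third_nonpos {v : ℝ} (h1 : 3 / 2 ≤ v) (h2 : v ≤ 9 / 2) :
    Real.cos (Real.pi / 3 * v) ≤ 0 := by
  have := Real.pi_pos
  exact Real.cos_nonpos_of_pi_div_two_le_of_le (by nlinarith) (by nlinarith)

lemma neg_half_le_cos_third {v : ℝ} (h1 : -2 ≤ v) (h2 : v ≤ 2) :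
    -(1 / 2) ≤ Real.cos (Real.pi / 3 * v) := by
  have := Real.pi_pos
  have h : Real.cos (Real.pi - Real.pi / 3) = -(1 / 2) := by
    rw [Real.cos_pi_sub, Real.cos_pi_div_three]
  rw [← h]
  refine cos_le_cos_of_abs_le (by linarith) (abs_le.2 ⟨by nlinarith, by nlinarith⟩)

lemma arcIntegral_mem_Icc_of_nonneg {k j : ℤ}
    (h : ∀ u : ℝ, 0 ≤ u → u ≤ 1 → 0 ≤ Real.cos (Real.pi / 3 * (k * u - j)))
    {x : ℝ} (hx0 : 0 ≤ x) (hx2 : x ≤ 2) :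
    0 ≤ arcIntegral k j x ∧ arcIntegral k j x ≤ arcIntegral k j 2 := by
  have hf : ∀ t, 0 ≤ t → t ≤ 2 → 0 ≤ Real.cos (Real.pi / 3 * (k * bumpPrimitive t - j)) :=
    fun t h0 h2 => h _ (bumpPrimitive_nonneg h0) (bumpPrimitive_le_one h2)
  have ii : ∀ a b, IntervalIntegrable
      (fun t => Real.cos (Real.pi / 3 * (k * bumpPrimitive t - j))) volume a b :=
    fun a b => (continuous_arcIntegrand k j).intervalIntegrable a b
  have e1 := intervalIntegral.integral_add_adjacent_intervals (ii 0 x) (ii x 2)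
  have e2 := intervalIntegral.integral_nonneg (μ := volume) hx0
    fun t ht => hf t ht.1 (ht.2.trans hx2)
  have e3 := intervalIntegral.integral_nonneg (μ := volume) hx2
    fun t ht => hf t (hx0.trans ht.1) ht.2
  unfold arcIntegral
  exact ⟨e2, by linarith⟩

lemma ArcRange.Holds.opposite {R : ArcRange} {k j : ℤ} (h : R.Holds k j) :
    R.opposite.Holds k (j + 3) := by
  refine ⟨?_, fun x h0 h2 => ?_⟩
  · rw [arcIntegral_add_three, ← h.1]
    exact LinForm.eval_neg _
  · rw [arcIntegral_add_three]
    have := h.2 x h0 h2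
    change LinForm.eval (-R.hi) ≤ _ ∧ _ ≤ LinForm.eval (-R.lo)
    rw [LinForm.eval_neg, LinForm.eval_neg]
    exact ⟨neg_le_neg this.2, neg_le_neg this.1⟩

/-- Reversing the arc turns "displacement from the start" into "end value minus displacement"; it
supplies the entries of the table in direction $k-j$ from those in direction $j$. -/
lemma ArcRange.Holds.reflect {R : ArcRange} {k j : ℤ} (h : R.Holds k j) :
    ArcRange.Holds ⟨R.net - R.hi, R.net - R.lo, R.net⟩ k (k - j) := by
  have h0 : arcIntegral k j 0 = 0 := intervalIntegral.integral_same
  refine ⟨?_, fun x hx0 hx2 => ?_⟩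
  · rw [← arcIntegral_two_sub, sub_self, h0, sub_zero]
    exact h.1
  · rw [← arcIntegral_two_sub, ← h.1]
    have := h.2 (2 - x) (by linarith) (by linarith)
    simp only [LinForm.eval_sub]
    exact ⟨by linarith, by linarith⟩

lemma ArcRange.Holds.of_eq {R : ArcRange} {k j j' : ℤ} (h : R.Holds k j) (hj : j = j') :
    R.Holds k j' := hj ▸ h

lemma holds_one_zero : ArcRange.Holds ⟨0, (1, 0, 0, 0), (1, 0, 0, 0)⟩ 1 0 := by
  have e : LinForm.eval (1, 0, 0, 0) = arcIntegral 1 0 2 := by simp [LinForm.eval]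
  refine ⟨e, fun x h0 h2 => ?_⟩
  rw [e, LinForm.eval_zero]
  refine arcIntegral_mem_Icc_of_nonneg (fun u hu0 hu1 => ?_) h0 h2
  push_cast
  exact cos_third_nonneg (by linarith) (by linarith)

/-- The direction is perpendicular to the chord, so the net displacement is 0. The opposite
direction $j=-1$ is unimodal: the tangent is perpendicular to it at $u=\frac12$, and the excursion
is at most $\frac12\cdot 1=\frac{12}{24}$. -/
lemma holds_one_two : ArcRange.Holds ⟨(0, 0, 0, -12), 0, 0⟩ 1 2 := by
  have z : arcIntegral 1 (-1) 2 = 0 := by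
    rw [arcIntegral_at_two]
    have : Real.pi / 3 * (((1 : ℤ) : ℝ) / 2 - ((-1 : ℤ) : ℝ)) = Real.pi / 2 := by
      push_cast
      ring
    rw [this, Real.cos_pi_div_two, zero_mul]
  have key : ArcRange.Holds ⟨0, (0, 0, 0, 12), 0⟩ 1 (-1) := by
    refine ⟨by rw [z, LinForm.eval_zero], fun x h0 h2 => ?_⟩
    have := arcIntegral_mem_Icc (k := 1) (j := -1) (a := 1 / 2) (δ := 1 / 2) le_rfl (by norm_num)
      (by norm_num)
      (fun u hu0 hu1 => by push_cast; exact cos_third_nonneg (by linarith) (by linarith))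
      (fun u hu0 hu1 => by
        push_cast
        exact ⟨cos_third_nonpos (by linarith) (by linarith),
          neg_half_le_cos_third (by linarith) (by linarith)⟩) z.ge h0 h2
    rw [z] at this
    rw [LinForm.eval_zero]
    refine ⟨this.1, this.2.trans ?_⟩
    norm_num [LinForm.eval]
  exact key.opposite

lemma holds_two_zero : ArcRange.Holds ⟨0, (0, 1, 0, 9), (0, 1, 0, 0)⟩ 2 0 := by
  refine ⟨by simp [LinForm.eval], fun x h0 h2 => ?_⟩
  -- The right angle $2u=\frac32$ is reached at $u=\frac34$, and the final angle $\frac{2\pi}{3}$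
  -- has cosine $-\frac12$. The overshoot is $\frac12(\frac32-\frac34)=\frac{9}{24}$.
  have := arcIntegral_mem_Icc (k := 2) (j := 0) (a := 3 / 4) (δ := 1 / 2) (by norm_num)
    (by norm_num) (by norm_num)
    (fun u hu0 hu1 => by push_cast; exact cos_third_nonneg (by linarith) (by linarith))
    (fun u hu0 hu1 => by
      push_cast
      exact ⟨cos_third_nonpos (by linarith) (by linarith),
        neg_half_le_cos_third (by linarith) (by linarith)⟩)
    (by rw [chord_two_zero]; linarith [one_le_chordLength_two]) h0 h2
  rw [LinForm.eval_zero]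
  refine ⟨this.1, this.2.trans ?_⟩
  norm_num [LinForm.eval]

lemma holds_two_one : ArcRange.Holds ⟨0, (0, 2, 0, 0), (0, 2, 0, 0)⟩ 2 1 := by
  have e : LinForm.eval (0, 2, 0, 0) = arcIntegral 2 1 2 := by
    rw [arcIntegral_at_two]
    simp [LinForm.eval, chord_two_zero]
  refine ⟨e, fun x h0 h2 => ?_⟩
  rw [e, LinForm.eval_zero]
  refine arcIntegral_mem_Icc_of_nonneg (fun u hu0 hu1 => ?_) h0 h2
  push_cast
  exact cos_third_nonneg (by linarith) (by linarith)

lemma holds_three_zero : ArcRange.Holds ⟨0, (0, 0, 0, 24), 0⟩ 3 0 := by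
  have z : arcIntegral 3 0 2 = 0 := by
    rw [arcIntegral_at_two]
    have : Real.pi / 3 * (((3 : ℤ) : ℝ) / 2 - ((0 : ℤ) : ℝ)) = Real.pi / 2 := by
      push_cast
      ring
    rw [this, Real.cos_pi_div_two, zero_mul]
  refine ⟨by rw [z, LinForm.eval_zero], fun x h0 h2 => ?_⟩
  -- The heading goes all the way to $\pi$, so only $\delta=1$ is available; the overshoot is
  -- $\frac{24}{24}$.
  have := arcIntegral_mem_Icc (k := 3) (j := 0) (a := 1 / 2) (δ := 1) le_rfl (by norm_num)
    (by norm_num)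
    (fun u hu0 hu1 => by push_cast; exact cos_third_nonneg (by linarith) (by linarith))
    (fun u hu0 hu1 => by
      push_cast
      exact ⟨cos_third_nonpos (by linarith) (by linarith), Real.neg_one_le_cos _⟩)
    z.ge h0 h2
  rw [z] at this
  rw [LinForm.eval_zero]
  refine ⟨this.1, this.2.trans ?_⟩
  norm_num [LinForm.eval]

lemma holds_three_one : ArcRange.Holds ⟨0, (0, 0, 1, 8), (0, 0, 1, 0)⟩ 3 1 := by
  refine ⟨by simp [LinForm.eval], fun x h0 h2 => ?_⟩
  -- The right angle $3u-1=\frac32$ is at $u=\frac56$, and the overshoot is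
  -- $\frac12(\frac32-\frac56)=\frac{8}{24}$.
  have := arcIntegral_mem_Icc (k := 3) (j := 1) (a := 5 / 6) (δ := 1 / 2) (by norm_num)
    (by norm_num) (by norm_num)
    (fun u hu0 hu1 => by push_cast; exact cos_third_nonneg (by linarith) (by linarith))
    (fun u hu0 hu1 => by
      push_cast
      exact ⟨cos_third_nonpos (by linarith) (by linarith),
        neg_half_le_cos_third (by linarith) (by linarith)⟩)
    (by
      rw [chord_three_one]
      exact mul_nonneg (by positivity) (by linarith [half_le_chordLength_three])) h0 h2
  rw [LinForm.eval_zero]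
  refine ⟨this.1, this.2.trans ?_⟩
  norm_num [LinForm.eval]

lemma baseRange_holds {k j : ℤ} (hk : k = 1 ∨ k = 2 ∨ k = 3) (hj : j = 0 ∨ j = 1 ∨ j = 2) :
    (baseRange k j).Holds k j := by
  rcases hk with rfl | rfl | rfl <;> rcases hj with rfl | rfl | rfl
  · exact holds_one_zero
  · exact holds_one_zero.reflect
  · exact holds_one_two
  · exact holds_two_zero
  · exact holds_two_one
  · exact holds_two_zero.reflect
  · exact holds_three_zero
  · exact holds_three_one
  · exact holds_three_one.reflect

lemma posRange_holds {k : ℤ} (hk : k = 1 ∨ k = 2 ∨ k = 3) (j : ℤ) : (posRange k j).Holds k j := by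
  have key : (posRange k j).Holds k (j % 6) := by
    unfold posRange
    split_ifs with h
    · exact baseRange_holds hk (by omega)
    · exact (baseRange_holds hk (by omega)).opposite.of_eq (by ring)
  refine ⟨?_, fun x h0 h2 => ?_⟩
  · rw [← arcIntegral_emod_six k j]
    exact key.1
  · rw [← arcIntegral_emod_six k j]
    exact key.2 x h0 h2

lemma arcRange_holds {k : ℤ} (hk : k = 1 ∨ k = -1 ∨ k = -2 ∨ k = 3) (j : ℤ) :
    (arcRange k j).Holds k j := by
  unfold arcRange
  split_ifs with h
  · have key := posRange_holds (k := -k) (by omega) (-j)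
    unfold ArcRange.Holds at key ⊢
    simpa only [arcIntegral_neg] using key
  · exact posRange_holds (by omega) j

/-- Along an arc of turn `k`, the tangent has positive component in direction `j`. -/
def Rises (k j : ℤ) : Prop :=
  (k = 1 ∧ (j % 6 = 0 ∨ j % 6 = 1)) ∨ (k = -1 ∧ (j % 6 = 0 ∨ j % 6 = 5)) ∨ (k = -2 ∧ j % 6 = 5)

instance (k j : ℤ) : Decidable (Rises k j) := by
  unfold Rises
  infer_instance

/-- In the listed cases $ku-j$ stays in $(-\frac32,\frac32)$ modulo 6. Turn 3 is absent because its
closed range already has length 3. -/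
lemma Rises.cos_pos {k j : ℤ} (h : Rises k j) {u : ℝ} (h0 : 0 ≤ u) (h1 : u ≤ 1) :
    0 < Real.cos (Real.pi / 3 * (k * u - j)) := by
  have e : Real.cos (Real.pi / 3 * (k * u - j))
      = Real.cos (Real.pi / 3 * (k * u - (j % 6 : ℤ))) := by
    rw [← Real.cos_add_int_mul_two_pi _ (j / 6)]
    congr 1
    have : ((j % 6 : ℤ) : ℝ) = j - 6 * (j / 6 : ℤ) := by
      exact_mod_cast (by omega : j % 6 = j - 6 * (j / 6))
    rw [this]
    ring
  have e5 : ∀ v : ℝ, Real.cos (Real.pi / 3 * (v - 5)) = Real.cos (Real.pi / 3 * (v + 1)) := by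
    intro v
    rw [← Real.cos_add_two_pi]
    congr 1
    ring
  rw [e]
  rcases h with ⟨rfl, h | h⟩ | ⟨rfl, h | h⟩ | ⟨rfl, h⟩ <;> rw [h] <;> push_cast <;>
    (try rw [e5]) <;> exact cos_third_pos (by linarith) (by linarith)

/-! ## Trains of bumps -/

/-- The function that equals `π / 3 * c n` times a unit bump on each interval `[2n, 2n + 2]`. -/
def bumpTrain (c : ℤ → ℤ) (s : ℝ) : ℝ :=
  Real.pi / 3 * (c ⌊s / 2⌋ * unitBump (s - 2 * ⌊s / 2⌋))

lemma exists_eq_two_mul_add (s : ℝ) : ∃ (n : ℤ) (x : ℝ), 0 ≤ x ∧ x < 2 ∧ s = 2 * n + x := by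
  refine ⟨⌊s / 2⌋, s - 2 * ⌊s / 2⌋, ?_, ?_, by ring⟩
  · linarith [Int.floor_le (s / 2)]
  · linarith [Int.lt_floor_add_one (s / 2)]

lemma bumpTrain_apply (c : ℤ → ℤ) (n : ℤ) {x : ℝ} (h0 : 0 ≤ x) (h2 : x ≤ 2) :
    bumpTrain c (2 * n + x) = Real.pi / 3 * (c n * unitBump x) := by
  rcases h2.lt_or_eq with h | rfl
  · have e : ⌊(2 * n + x) / 2⌋ = n := by
      rw [Int.floor_eq_iff]
      constructor <;> linarith
    unfold bumpTrain
    rw [e, add_sub_cancel_left]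
  -- At the right endpoint the floor belongs to the next interval, but both bumps vanish there.
  · have e : ⌊(2 * n + (2 : ℝ)) / 2⌋ = n + 1 := by
      rw [show (2 * n + (2 : ℝ)) / 2 = ((n + 1 : ℤ) : ℝ) by push_cast; ring, Int.floor_intCast]
    unfold bumpTrain
    rw [e, unitBump_of_two_le le_rfl]
    push_cast
    rw [show 2 * (n : ℝ) + 2 - 2 * (n + 1) = 0 by ring, unitBump_of_nonpos le_rfl]
    simp

/-- On a neighbourhood of the joint $2n$ the train is a sum of two globally smooth functions; this
gives smoothness and the derivative without gluing arguments. -/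
lemma bumpTrain_eq_two_bumps (c : ℤ → ℤ) (n : ℤ) {s : ℝ} (h1 : 2 * (n : ℝ) - 2 < s)
    (h2 : s < 2 * n + 2) :
    bumpTrain c s = Real.pi / 3 *
      (c (n - 1) * unitBump (s - 2 * (n - 1)) + c n * unitBump (s - 2 * n)) := by
  rcases le_total (2 * (n : ℝ)) s with h | h
  · have e := bumpTrain_apply c n (x := s - 2 * n) (by linarith) (by linarith)
    rw [add_sub_cancel] at e
    rw [e, unitBump_of_two_le (x := s - 2 * (n - 1)) (by linarith), mul_zero, zero_add]
  · have e := bumpTrain_apply c (n - 1) (x := s - 2 * (n - 1)) (by linarith) (by linarith)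
    push_cast at e
    rw [add_sub_cancel] at e
    rw [e, unitBump_of_nonpos (x := s - 2 * n) (by linarith), mul_zero, add_zero]

lemma contDiff_bumpTrain (c : ℤ → ℤ) : ContDiff ℝ ∞ (bumpTrain c) := by
  rw [contDiff_iff_contDiffAt]
  intro s
  obtain ⟨n, x, h0, h2, rfl⟩ := exists_eq_two_mul_add s
  have h : ContDiff ℝ ∞ fun s : ℝ => Real.pi / 3 *
      (c (n - 1) * unitBump (s - 2 * (n - 1)) + c n * unitBump (s - 2 * n)) :=
    contDiff_const.mul ((contDiff_const.mul (contDiff_unitBump.comp (contDiff_id.sub contDiff_const))).add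
      (contDiff_const.mul (contDiff_unitBump.comp (contDiff_id.sub contDiff_const))))
  refine h.contDiffAt.congr_of_eventuallyEq ?_
  filter_upwards [Ioo_mem_nhds (show 2 * (n : ℝ) - 2 < 2 * n + x by linarith)
    (show 2 * n + x < 2 * (n : ℝ) + 2 by linarith)] with s hs
  exact bumpTrain_eq_two_bumps c n hs.1 hs.2

lemma continuous_bumpTrain (c : ℤ → ℤ) : Continuous (bumpTrain c) := (contDiff_bumpTrain c).continuous

lemma deriv_bumpTrain_of_lt (c : ℤ → ℤ) (n : ℤ) {x : ℝ} (h0 : 0 ≤ x) (h2 : x < 2) :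
    deriv (bumpTrain c) (2 * n + x) = Real.pi / 3 * (c n * deriv unitBump x) := by
  have h : bumpTrain c =ᶠ[𝓝 (2 * n + x)] fun s : ℝ => Real.pi / 3 *
      (c (n - 1) * unitBump (s - 2 * (n - 1)) + c n * unitBump (s - 2 * n)) := by
    filter_upwards [Ioo_mem_nhds (show 2 * (n : ℝ) - 2 < 2 * n + x by linarith)
      (show 2 * n + x < 2 * (n : ℝ) + 2 by linarith)] with s hs
    exact bumpTrain_eq_two_bumps c n hs.1 hs.2
  have d : ∀ a y : ℝ, HasDerivAt (fun s => unitBump (s - a)) (deriv unitBump (y - a)) y :=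
    fun a y => (differentiable_unitBump (y - a)).hasDerivAt.comp_sub_const y a
  rw [h.deriv_eq]
  have e := (((d (2 * (n - 1)) (2 * n + x)).const_mul (c (n - 1) : ℝ)).add
    ((d (2 * n) (2 * n + x)).const_mul (c n : ℝ))).const_mul (Real.pi / 3)
  rw [HasDerivAt.deriv (by exact e), deriv_unitBump_eq_zero_of_eq_zero
    (x := 2 * n + x - 2 * (n - 1)) (unitBump_of_two_le (by linarith)), add_sub_cancel_left,
    mul_zero, zero_add]

lemma deriv_bumpTrain (c : ℤ → ℤ) (n : ℤ) {x : ℝ} (h0 : 0 ≤ x) (h2 : x ≤ 2) :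
    deriv (bumpTrain c) (2 * n + x) = Real.pi / 3 * (c n * deriv unitBump x) := by
  rcases h2.lt_or_eq with h | rfl
  · exact deriv_bumpTrain_of_lt c n h0 h
  · have e := deriv_bumpTrain_of_lt c (n + 1) (x := 0) le_rfl (by norm_num)
    push_cast at e
    rw [show 2 * ((n : ℝ) + 1) + 0 = 2 * n + 2 by ring,
      deriv_unitBump_eq_zero_of_eq_zero (unitBump_of_nonpos le_rfl)] at e
    rw [e, deriv_unitBump_eq_zero_of_eq_zero (unitBump_of_two_le le_rfl)]
    simp

lemma deriv_bumpTrain_eq_zero_iff {c : ℤ → ℤ} (hc : ∀ n, c n ≠ 0) (s : ℝ) :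
    deriv (bumpTrain c) s = 0 ↔ ∃ n : ℤ, s = n := by
  obtain ⟨n, x, h0, h2, rfl⟩ := exists_eq_two_mul_add s
  have hn : (c n : ℝ) ≠ 0 := by exact_mod_cast hc n
  rw [deriv_bumpTrain c n h0 h2.le, mul_eq_zero, mul_eq_zero, or_iff_right (by positivity),
    or_iff_right hn, deriv_unitBump_eq_zero_iff h0 h2.le]
  constructor
  · rintro (rfl | rfl | rfl)
    · exact ⟨2 * n, by push_cast; ring⟩
    · exact ⟨2 * n + 1, by push_cast; ring⟩
    · exact ⟨2 * n + 2, by push_cast; ring⟩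
  · rintro ⟨m, hm⟩
    have hx : x = ((m - 2 * n : ℤ) : ℝ) := by push_cast; linarith
    have h0' : 0 ≤ m - 2 * n := by rw [hx] at h0; exact_mod_cast h0
    have h2' : m - 2 * n < 2 := by rw [hx] at h2; exact_mod_cast h2
    rw [hx]
    rcases (by omega : m - 2 * n = 0 ∨ m - 2 * n = 1) with h | h <;> rw [h] <;> simp

lemma bumpTrain_eq_zero_iff {c : ℤ → ℤ} (hc : ∀ n, c n ≠ 0) (s : ℝ) :
    bumpTrain c s = 0 ↔ ∃ n : ℤ, s = 2 * n := by
  obtain ⟨n, x, h0, h2, rfl⟩ := exists_eq_two_mul_add s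
  have hn : (c n : ℝ) ≠ 0 := by exact_mod_cast hc n
  rw [bumpTrain_apply c n h0 h2.le, mul_eq_zero, mul_eq_zero, or_iff_right (by positivity),
    or_iff_right hn, unitBump_eq_zero_iff, or_iff_left h2.not_ge]
  constructor
  · intro h
    exact ⟨n, by linarith⟩
  · rintro ⟨m, hm⟩
    have h3 : ((m - n : ℤ) : ℝ) < 1 := by push_cast; linarith
    have h4 : m - n < 1 := by exact_mod_cast h3
    have h5 : ((m - n : ℤ) : ℝ) ≤ 0 := by exact_mod_cast (by omega : m - n ≤ 0)
    push_cast at h5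
    linarith

lemma bumpTrain_shift {c c' : ℤ → ℤ} {m : ℤ} (h : ∀ n, c n = c' (n + m)) (s : ℝ) :
    bumpTrain c s = bumpTrain c' (s + 2 * m) := by
  obtain ⟨n, x, h0, h2, rfl⟩ := exists_eq_two_mul_add s
  have e := bumpTrain_apply c' (n + m) h0 h2.le
  rw [bumpTrain_apply c n h0 h2.le, h n, ← e]
  congr 1
  push_cast
  ring

/-- With no zero height the zeros of a train are exactly the even integers, so a shift must be even;
comparing values at odd integers then reads off the heights. -/
lemma exists_shift_of_bumpTrain {c c' : ℤ → ℤ} (hc : ∀ n, c n ≠ 0) (hc' : ∀ n, c' n ≠ 0) {T : ℝ}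
    (h : ∀ s, bumpTrain c s = bumpTrain c' (s + T)) :
    ∃ m : ℤ, T = 2 * m ∧ ∀ n, c n = c' (n + m) := by
  have h0 : bumpTrain c' T = 0 := by
    rw [← zero_add T, ← h 0, bumpTrain_eq_zero_iff hc]
    exact ⟨0, by simp⟩
  obtain ⟨m, rfl⟩ := (bumpTrain_eq_zero_iff hc' T).1 h0
  refine ⟨m, rfl, fun n => ?_⟩
  have e1 := bumpTrain_apply c n (x := 1) zero_le_one one_le_two
  have e2 := bumpTrain_apply c' (n + m) (x := 1) zero_le_one one_le_two
  have e3 := h (2 * n + 1)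
  rw [show 2 * (n : ℝ) + 1 + 2 * m = 2 * ((n + m : ℤ) : ℝ) + 1 by push_cast; ring, e1, e2,
    unitBump_one, mul_one, mul_one] at e3
  have e4 : (c n : ℝ) = c' (n + m) := mul_left_cancel₀ (by positivity) e3
  exact_mod_cast e4

/-! ## The four coefficient sequences -/

/-- Bump heights of the first curvature function over a period. -/
def heightA (r : ℤ) : ℤ := if r = 0 then 1 else if r = 1 then -2 else if r = 2 then 3 else -1

/-- Bump heights of the second curvature function over a period. -/
def heightB (r : ℤ) : ℤ := if r = 0 then 1 else if r = 1 then 3 else if r = 2 then -2 else -1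

/-- Bump heights of the four curvature functions. -/
def height (i : Fin 4) (n : ℤ) : ℤ :=
  if i = 0 then heightA (n % 4)
  else if i = 1 then heightB (n % 4)
  else if i = 2 then if n % 8 < 4 then heightA (n % 4) else heightB (n % 4)
  else if n % 12 < 4 ∨ 8 ≤ n % 12 then heightA (n % 4) else heightB (n % 4)

lemma height_add (i : Fin 4) (n m : ℤ) : height i (n + 24 * m) = height i n := by
  unfold height
  rw [show (n + 24 * m) % 4 = n % 4 by omega, show (n + 24 * m) % 8 = n % 8 by omega,
    show (n + 24 * m) % 12 = n % 12 by omega]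

lemma height_emod (i : Fin 4) (n : ℤ) : height i (n % 24) = height i n := by
  rw [← height_add i (n % 24) (n / 24), Int.emod_add_mul_ediv]

lemma height_mem (i : Fin 4) (n : ℤ) :
    height i n = 1 ∨ height i n = -1 ∨ height i n = -2 ∨ height i n = 3 := by
  unfold height heightA heightB
  split_ifs <;> simp

lemma height_ne_zero (i : Fin 4) (n : ℤ) : height i n ≠ 0 := by
  have := height_mem i n
  omega

lemma periodicExtension_apply {N : ℤ} {L : ℝ} (hN : 0 < N) (hL : L = 2 * N) (φ : ℝ → ℝ) (n : ℤ) {x : ℝ} (h0 : 0 ≤ x)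
    (h2 : x < 2) :
    periodicExtension L φ (2 * n + x) = φ (2 * ((n % N : ℤ) : ℝ) + x) := by
  subst hL
  have hN' : (0 : ℝ) < N := by exact_mod_cast hN
  have e : ((n % N : ℤ) : ℝ) = n - N * (n / N : ℤ) := by
    rw [Int.emod_def]
    push_cast
    ring
  have h3 : ((n % N : ℤ) : ℝ) + 1 ≤ N := by exact_mod_cast Int.emod_lt_of_pos n hN
  have h4 : (0 : ℝ) ≤ ((n % N : ℤ) : ℝ) := by exact_mod_cast Int.emod_nonneg n hN.ne'
  have h5 : ⌊(2 * n + x) / (2 * N)⌋ = n / N := by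
    rw [Int.floor_eq_iff, le_div_iff₀ (by positivity), div_lt_iff₀ (by positivity)]
    constructor <;> nlinarith
  unfold periodicExtension
  congr 1
  rw [Int.fract, h5, e]
  field_simp
  ring

lemma unitBump_train (r : ℤ) {x : ℝ} (h0 : 0 ≤ x) (h2 : x < 2) (m : ℤ) :
    unitBump (2 * (r : ℝ) + x - 2 * m) = if r = m then unitBump x else 0 := by
  split_ifs with h
  · rw [h, add_sub_cancel_left]
  · rcases lt_or_gt_of_ne h with h | h
    · have : (r : ℝ) + 1 ≤ m := by exact_mod_cast h
      exact unitBump_of_nonpos (by linarith)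
    · have : (m : ℝ) + 1 ≤ r := by exact_mod_cast h
      exact unitBump_of_two_le (by linarith)

lemma bump_train (r : ℤ) {x : ℝ} (h0 : 0 ≤ x) (h2 : x < 2) {r₁ r₂ : ℝ} (m : ℤ)
    (h₁ : r₁ = 2 * m) (h₂ : r₂ = 2 * m + 2) :
    bump r₁ r₂ (2 * r + x) = if r = m then unitBump x else 0 := by
  rw [bump_eq (by rw [h₁, h₂]), h₁, unitBump_train r h0 h2]

lemma kappa₁_apply (n : ℤ) {x : ℝ} (h0 : 0 ≤ x) (h2 : x < 2) :
    kappa₁ (2 * n + x) = Real.pi / 3 * (heightA (n % 4) * unitBump x) := by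
  unfold kappa₁
  rw [periodicExtension_apply (N := 4) (by norm_num) (by norm_num) _ n h0 h2]
  rw [bump_train _ h0 h2 0 (by simp) (by simp),
    bump_train _ h0 h2 1 (by norm_num) (by norm_num),
    bump_train _ h0 h2 2 (by norm_num) (by norm_num),
    bump_train _ h0 h2 3 (by norm_num) (by norm_num)]
  rcases (by omega : n % 4 = 0 ∨ n % 4 = 1 ∨ n % 4 = 2 ∨ n % 4 = 3) with h | h | h | h <;>
    simp [h, heightA]

lemma kappa₂_apply (n : ℤ) {x : ℝ} (h0 : 0 ≤ x) (h2 : x < 2) :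
    kappa₂ (2 * n + x) = Real.pi / 3 * (heightB (n % 4) * unitBump x) := by
  unfold kappa₂
  rw [periodicExtension_apply (N := 4) (by norm_num) (by norm_num) _ n h0 h2]
  rw [bump_train _ h0 h2 0 (by simp) (by simp),
    bump_train _ h0 h2 1 (by norm_num) (by norm_num),
    bump_train _ h0 h2 2 (by norm_num) (by norm_num),
    bump_train _ h0 h2 3 (by norm_num) (by norm_num)]
  rcases (by omega : n % 4 = 0 ∨ n % 4 = 1 ∨ n % 4 = 2 ∨ n % 4 = 3) with h | h | h | h <;>
    simp [h, heightB]

/-- The piecewise definitions of $\kappa_3$ and $\kappa_4$ split at $s\le 8$ and $s\le 16$. The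
excluded case is the splitting point itself, where both pieces vanish. -/
lemma le_two_mul_iff {r m : ℤ} {x : ℝ} (h0 : 0 ≤ x) (h2 : x < 2) (h : ¬(r = m ∧ x = 0)) :
    2 * (r : ℝ) + x ≤ 2 * m ↔ r < m := by
  constructor
  · intro h3
    by_contra! h4
    have h5 : (m : ℝ) ≤ r := by exact_mod_cast h4
    have h6 : (m : ℝ) = r := by linarith
    exact h ⟨by exact_mod_cast h6.symm, by linarith⟩
  · intro h3
    have : (r : ℝ) + 1 ≤ m := by exact_mod_cast h3
    linarith

lemma kappa₃_apply (n : ℤ) {x : ℝ} (h0 : 0 ≤ x) (h2 : x < 2) :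
    kappa₃ (2 * n + x) = Real.pi / 3 * (height 2 n * unitBump x) := by
  unfold kappa₃
  rw [periodicExtension_apply (N := 8) (by norm_num) (by norm_num) _ n h0 h2,
    kappa₁_apply _ h0 h2, kappa₂_apply _ h0 h2]
  by_cases hx : x = 0
  · simp [hx, unitBump_of_nonpos le_rfl]
  · have e := le_two_mul_iff (r := n % 8) (m := 4) h0 h2 (by tauto)
    rw [show 2 * ((4 : ℤ) : ℝ) = 8 by norm_num] at e
    simp only [e]
    rw [show n % 8 % 4 = n % 4 by omega]
    by_cases h : n % 8 < 4 <;> simp [height, h]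

lemma kappa₄_apply (n : ℤ) {x : ℝ} (h0 : 0 ≤ x) (h2 : x < 2) :
    kappa₄ (2 * n + x) = Real.pi / 3 * (height 3 n * unitBump x) := by
  unfold kappa₄
  rw [periodicExtension_apply (N := 12) (by norm_num) (by norm_num) _ n h0 h2,
    kappa₁_apply _ h0 h2, kappa₂_apply _ h0 h2]
  by_cases hx : x = 0
  · simp [hx, unitBump_of_nonpos le_rfl]
  · have e := le_two_mul_iff (r := n % 12) (m := 4) h0 h2 (by tauto)
    have e' := le_two_mul_iff (r := n % 12) (m := 8) h0 h2 (by tauto)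
    rw [show 2 * ((4 : ℤ) : ℝ) = 8 by norm_num] at e
    rw [show 2 * ((8 : ℤ) : ℝ) = 16 by norm_num] at e'
    simp only [e, e']
    rw [show n % 12 % 4 = n % 4 by omega]
    by_cases h : n % 12 < 4
    · simp [height, h]
    · by_cases h' : n % 12 < 8 <;> simp [height, h, h']

lemma kappa_eq_bumpTrain (i : Fin 4) : kappa i = bumpTrain (height i) := by
  funext s
  obtain ⟨n, x, h0, h2, rfl⟩ := exists_eq_two_mul_add s
  rw [bumpTrain_apply _ n h0 h2.le]
  fin_cases i
  · exact kappa₁_apply n h0 h2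
  · exact kappa₂_apply n h0 h2
  · exact kappa₃_apply n h0 h2
  · exact kappa₄_apply n h0 h2

/-! ## Unit speed curves with prescribed curvature -/

/-- Turning angle of the curve with curvature `κ`. -/
def turning (κ : ℝ → ℝ) (s : ℝ) : ℝ := ∫ u in (0 : ℝ)..s, κ u

/-- Displacement of the curve with curvature `κ` in the direction of angle `θ`. -/
def progress (κ : ℝ → ℝ) (θ s : ℝ) : ℝ := ∫ t in (0 : ℝ)..s, Real.cos (turning κ t - θ)

section Curve

variable {κ : ℝ → ℝ}

lemma hasDerivAt_turning (hκ : Continuous κ) (s : ℝ) : HasDerivAt (turning κ) (κ s) s :=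
  intervalIntegral.integral_hasDerivAt_right (hκ.intervalIntegrable 0 s)
    (hκ.stronglyMeasurableAtFilter _ _) hκ.continuousAt

lemma continuous_turning (hκ : Continuous κ) : Continuous (turning κ) :=
  continuous_iff_continuousAt.2 fun s => (hasDerivAt_turning hκ s).continuousAt

lemma continuous_cos_turning_sub (hκ : Continuous κ) (θ : ℝ) :
    Continuous fun t => Real.cos (turning κ t - θ) := by
  have := continuous_turning hκ
  fun_prop

lemma curveOf_zero_apply (κ : ℝ → ℝ) (s : ℝ) :
    curveOf κ s 0 = ∫ t in (0 : ℝ)..s, Real.cos (turning κ t) := rfl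

lemma curveOf_one_apply (κ : ℝ → ℝ) (s : ℝ) :
    curveOf κ s 1 = ∫ t in (0 : ℝ)..s, Real.sin (turning κ t) := rfl

lemma integral_cos_turning_sub (hκ : Continuous κ) (θ a b : ℝ) :
    ∫ t in a..b, Real.cos (turning κ t - θ)
      = Real.cos θ * (∫ t in a..b, Real.cos (turning κ t))
        + Real.sin θ * ∫ t in a..b, Real.sin (turning κ t) := by
  have c := continuous_turning hκ
  have c1 : Continuous fun t => Real.cos (turning κ t) := by fun_prop
  have c2 : Continuous fun t => Real.sin (turning κ t) := by fun_prop
  rw [← intervalIntegral.integral_const_mul, ← intervalIntegral.integral_const_mul,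
    ← intervalIntegral.integral_add ((c1.const_mul _).intervalIntegrable _ _)
      ((c2.const_mul _).intervalIntegrable _ _)]
  congr 1
  funext t
  rw [Real.cos_sub]
  ring

lemma progress_eq (hκ : Continuous κ) (θ s : ℝ) :
    progress κ θ s = Real.cos θ * curveOf κ s 0 + Real.sin θ * curveOf κ s 1 :=
  integral_cos_turning_sub hκ θ 0 s

lemma progress_sub (hκ : Continuous κ) (θ a b : ℝ) :
    progress κ θ b - progress κ θ a = ∫ t in a..b, Real.cos (turning κ t - θ) :=
  intervalIntegral.integral_interval_sub_left
    ((continuous_cos_turning_sub hκ θ).intervalIntegrable _ _)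
    ((continuous_cos_turning_sub hκ θ).intervalIntegrable _ _)

lemma turning_add {κ' : ℝ → ℝ} (hκ' : Continuous κ') {c : ℝ} (h : ∀ t, κ t = κ' (t + c)) (t : ℝ) :
    turning κ' (t + c) = turning κ' c + turning κ t := by
  have e1 := intervalIntegral.integral_add_adjacent_intervals
    (hκ'.intervalIntegrable 0 c) (hκ'.intervalIntegrable (μ := volume) c (t + c))
  have e2 := intervalIntegral.integral_comp_add_right (a := 0) (b := t) κ' c
  simp only [← h, zero_add] at e2
  unfold turning
  rw [e2, e1]

lemma integral_turning_add {κ' : ℝ → ℝ} (hκ' : Continuous κ') {c : ℝ}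
    (h : ∀ t, κ t = κ' (t + c)) {f : ℝ → ℝ} (hf : Continuous f) (t : ℝ) :
    ∫ u in (0 : ℝ)..(t + c), f (turning κ' u)
      = (∫ u in (0 : ℝ)..c, f (turning κ' u))
        + ∫ u in (0 : ℝ)..t, f (turning κ' c + turning κ u) := by
  have hc : Continuous fun u => f (turning κ' u) := hf.comp (continuous_turning hκ')
  have e1 := intervalIntegral.integral_add_adjacent_intervals
    (hc.intervalIntegrable 0 c) (hc.intervalIntegrable (μ := volume) c (t + c))
  have e2 := intervalIntegral.integral_comp_add_right (a := 0) (b := t)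
    (fun u => f (turning κ' u)) c
  simp only [turning_add hκ' h, zero_add] at e2
  rw [e2, e1]

/-- Curvature determines the curve up to a motion: restarting at $c$ means rotating by the angle
turned so far and translating to the point reached. -/
lemma curveOf_add_zero_apply (hκ : Continuous κ) {κ' : ℝ → ℝ} (hκ' : Continuous κ') {c : ℝ}
    (h : ∀ t, κ t = κ' (t + c)) (t : ℝ) :
    curveOf κ' (t + c) 0 = curveOf κ' c 0 + (Real.cos (turning κ' c) * curveOf κ t 0
      - Real.sin (turning κ' c) * curveOf κ t 1) := by
  have e := integral_cos_turning_sub hκ (-turning κ' c) 0 t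
  rw [Real.cos_neg, Real.sin_neg, neg_mul] at e
  simp only [curveOf_zero_apply, curveOf_one_apply]
  rw [← sub_eq_add_neg] at e
  rw [integral_turning_add hκ' h Real.continuous_cos, ← e]
  congr 2
  funext u
  congr 1
  ring

lemma curveOf_add_one_apply (hκ : Continuous κ) {κ' : ℝ → ℝ} (hκ' : Continuous κ') {c : ℝ}
    (h : ∀ t, κ t = κ' (t + c)) (t : ℝ) :
    curveOf κ' (t + c) 1 = curveOf κ' c 1 + (Real.sin (turning κ' c) * curveOf κ t 0
      + Real.cos (turning κ' c) * curveOf κ t 1) := by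
  have e := integral_cos_turning_sub hκ (Real.pi / 2 - turning κ' c) 0 t
  rw [Real.cos_pi_div_two_sub, Real.sin_pi_div_two_sub] at e
  simp only [curveOf_zero_apply, curveOf_one_apply]
  rw [integral_turning_add hκ' h Real.continuous_sin, ← e]
  congr 2
  funext u
  rw [← Real.cos_sub_pi_div_two]
  congr 1
  ring

end Curve

/-! ## Curves whose curvature is a train of bumps -/

/-- Heading, in units of `π / 3`, at the beginning of the `n`-th arc. -/
def heading (c : ℤ → ℤ) : ℕ → ℤ
  | 0 => 0
  | n + 1 => heading c n + c n

/-- Displacement in direction `j π / 3` at the beginning of the `n`-th arc. -/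
def position (c : ℤ → ℤ) (j : ℤ) : ℕ → LinForm
  | 0 => 0
  | n + 1 => position c j n + (arcRange (c n) (j - heading c n)).net

lemma turning_bumpTrain (c : ℤ → ℤ) (n : ℕ) {x : ℝ} (h0 : 0 ≤ x) (h2 : x ≤ 2) :
    turning (bumpTrain c) (2 * n + x) = Real.pi / 3 * (heading c n + c n * bumpPrimitive x) := by
  have step : ∀ (n : ℕ) (x : ℝ), 0 ≤ x → x ≤ 2 → turning (bumpTrain c) (2 * n + x)
      = turning (bumpTrain c) (2 * n) + Real.pi / 3 * (c n * bumpPrimitive x) := by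
    intro n x h0 h2
    have hc := continuous_bumpTrain c
    have e1 := intervalIntegral.integral_add_adjacent_intervals
      (hc.intervalIntegrable 0 (2 * (n : ℝ))) (hc.intervalIntegrable (μ := volume) _ (2 * n + x))
    have e2 := intervalIntegral.integral_comp_add_left (a := 0) (b := x) (bumpTrain c) (2 * (n : ℝ))
    rw [add_zero] at e2
    have e3 : ∫ t in (0 : ℝ)..x, bumpTrain c (2 * n + t)
        = ∫ t in (0 : ℝ)..x, Real.pi / 3 * (c n * unitBump t) := by
      refine intervalIntegral.integral_congr fun t ht => ?_
      rw [uIcc_of_le h0] at ht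
      exact bumpTrain_apply c n ht.1 (ht.2.trans h2)
    rw [intervalIntegral.integral_const_mul, intervalIntegral.integral_const_mul] at e3
    unfold turning bumpPrimitive
    rw [← e1, ← e2, e3]
  have base : ∀ n : ℕ, turning (bumpTrain c) (2 * n) = Real.pi / 3 * heading c n := by
    intro n
    induction n with
    | zero => simp [turning, heading]
    | succ n ih =>
      have := step n 2 zero_le_two le_rfl
      rw [ih, bumpPrimitive_two] at this
      push_cast [heading]
      rw [mul_add (2 : ℝ), mul_one, this]
      ring
  rw [step n x h0 h2, base]
  ring

lemma progress_sub_arc (c : ℤ → ℤ) (n : ℕ) (θ : ℝ) {x y : ℝ} (hx0 : 0 ≤ x) (hxy : x ≤ y)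
    (hy2 : y ≤ 2) :
    progress (bumpTrain c) θ (2 * n + y) - progress (bumpTrain c) θ (2 * n + x)
      = ∫ t in x..y, Real.cos (Real.pi / 3 * (heading c n + c n * bumpPrimitive t) - θ) := by
  rw [progress_sub (continuous_bumpTrain c), ← intervalIntegral.integral_comp_add_left
    (fun t => Real.cos (turning (bumpTrain c) t - θ))]
  refine intervalIntegral.integral_congr fun t ht => ?_
  rw [uIcc_of_le hxy] at ht
  rw [turning_bumpTrain c n (hx0.trans ht.1) (ht.2.trans hy2)]

lemma progress_arc (c : ℤ → ℤ) (j : ℤ) (n : ℕ) {x : ℝ} (h0 : 0 ≤ x) (h2 : x ≤ 2) :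
    progress (bumpTrain c) (Real.pi / 3 * j) (2 * n + x)
      = progress (bumpTrain c) (Real.pi / 3 * j) (2 * n)
        + arcIntegral (c n) (j - heading c n) x := by
  have h := progress_sub_arc c n (Real.pi / 3 * j) le_rfl h0 h2
  rw [add_zero, sub_eq_iff_eq_add'] at h
  rw [h]
  unfold arcIntegral
  congr 2
  funext t
  congr 1
  push_cast
  ring

lemma progress_eq_position {c : ℤ → ℤ} (hc : ∀ n, c n = 1 ∨ c n = -1 ∨ c n = -2 ∨ c n = 3)
    (j : ℤ) (n : ℕ) :
    progress (bumpTrain c) (Real.pi / 3 * j) (2 * n) = (position c j n).eval := by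
  induction n with
  | zero => simp [progress, position, LinForm.eval_zero]
  | succ n ih =>
    have h := progress_arc c j n (zero_le_two) le_rfl
    rw [position, LinForm.eval_add, (arcRange_holds (hc n) _).1, ← ih, ← h]
    push_cast
    rw [mul_add (2 : ℝ), mul_one]

/-! ## Separation of the arcs -/

/-- The `m`-th and the `n`-th arc are separated in direction `j`. -/
def SeparatedIn (c : ℤ → ℤ) (m n : ℕ) (j : ℤ) : Prop :=
  0 < ((position c j n + (arcRange (c n) (j - heading c n)).lo)
    - (position c j m + (arcRange (c m) (j - heading c m)).hi)).lower

instance (c : ℤ → ℤ) (m n : ℕ) (j : ℤ) : Decidable (SeparatedIn c m n j) := by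
  unfold SeparatedIn
  infer_instance

/-- The `n`-th arc and the next one are separated in direction `j`, except for their common
point. -/
def ConsecutiveSeparatedIn (c : ℤ → ℤ) (n : ℕ) (j : ℤ) : Prop :=
  (Rises (c n) (j - heading c n) ∧
    (arcRange (c (n + 1)) (j - heading c (n + 1))).lo = 0) ∨
  ((arcRange (c n) (j - heading c n)).hi = (arcRange (c n) (j - heading c n)).net ∧
    Rises (c (n + 1)) (j - heading c (n + 1)))

instance (c : ℤ → ℤ) (n : ℕ) (j : ℤ) : Decidable (ConsecutiveSeparatedIn c n j) := by
  unfold ConsecutiveSeparatedIn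
  infer_instance

/-- A combinatorial certificate for the train of bumps with heights `c` to be the curvature of a
simple closed curve of `24` arcs. -/
structure SimpleClosedTrain (c : ℤ → ℤ) : Prop where
  mem : ∀ n, c n = 1 ∨ c n = -1 ∨ c n = -2 ∨ c n = 3
  periodic : ∀ n, c n = c (n + 24)
  heading_end : heading c 24 = 6
  position_end : position c 0 24 = 0 ∧ position c 1 24 = 0
  consecutive : ∀ n < 24, ∃ j < 6, ConsecutiveSeparatedIn c n (j : ℕ)
  separated : ∀ n < 24, ∀ m < n, 2 ≤ n - m → n - m ≤ 22 →
    ∃ j < 3, SeparatedIn c m n (j : ℕ) ∨ SeparatedIn c n m (j : ℕ)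

/-- Finite integer checks. Closing is an exact cancellation of linear forms; only the separation of
non-adjacent arcs uses the numerical bounds. Three directions suffice there since both orders are
tried. -/
lemma height_simpleClosedTrain (i : Fin 4) : SimpleClosedTrain (height i) where
  mem := height_mem i
  periodic n := (height_add i n 1).symm
  heading_end := by revert i; decide +kernel
  position_end := by revert i; decide +kernel
  consecutive := by revert i; decide +kernel
  separated := by revert i; decide +kernel

lemma progress_eq_of_curveOf_eq {κ : ℝ → ℝ} (hκ : Continuous κ) {s t : ℝ}
    (h : curveOf κ s = curveOf κ t) (θ : ℝ) : progress κ θ s = progress κ θ t := by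
  rw [progress_eq hκ, progress_eq hκ, h]

lemma intCast_arcIntegrand (k h j : ℤ) (u : ℝ) :
    Real.cos (Real.pi / 3 * (h + k * u) - Real.pi / 3 * j)
      = Real.cos (Real.pi / 3 * (k * u - (j - h : ℤ))) := by
  congr 1
  push_cast
  ring

section Train

variable {c : ℤ → ℤ}

/-- An arc does not meet itself. -/
lemma curveOf_ne_of_same_arc (hc : ∀ n, c n = 1 ∨ c n = -1 ∨ c n = -2 ∨ c n = 3) (n : ℕ) {x y : ℝ}
    (hx0 : 0 ≤ x) (hxy : x < y) (hy2 : y ≤ 2) :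
    curveOf (bumpTrain c) (2 * n + x) ≠ curveOf (bumpTrain c) (2 * n + y) := by
  intro h
  -- The direction is the mean heading of the arc, from which the tangent deviates by at most
  -- $\frac{\pi}{2}$.
  have h1 := progress_eq_of_curveOf_eq (continuous_bumpTrain c) h
    (Real.pi / 3 * (heading c n + c n / 2))
  have h2 := progress_sub_arc c n (Real.pi / 3 * (heading c n + c n / 2)) hx0 hxy.le hy2
  rw [h1, sub_self] at h2
  refine h2.not_lt (intervalIntegral.intervalIntegral_pos_of_pos_on ?_ ?_ hxy)
  · have := continuous_bumpPrimitive
    exact Continuous.intervalIntegrable (by fun_prop) _ _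
  · intro t ht
    -- Strict bounds are needed because an arc of turn 3 reaches $\pm\frac{\pi}{2}$ at its ends.
    have t0 : 0 < bumpPrimitive t := by
      rw [← bumpPrimitive_zero]
      exact strictMonoOn_bumpPrimitive ⟨le_rfl, zero_le_two⟩ ⟨by linarith [ht.1], by linarith [ht.2]⟩
        (by linarith [ht.1])
    have t1 : bumpPrimitive t < 1 := by
      rw [← bumpPrimitive_two]
      exact strictMonoOn_bumpPrimitive ⟨by linarith [ht.1], by linarith [ht.2]⟩ ⟨zero_le_two, le_rfl⟩
        (by linarith [ht.2])
    have e : Real.pi / 3 * (heading c n + c n * bumpPrimitive t)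
        - Real.pi / 3 * (heading c n + c n / 2)
        = Real.pi / 3 * (c n * (bumpPrimitive t - 1 / 2)) := by ring
    rw [e]
    rcases hc n with h | h | h | h <;> rw [h] <;> push_cast <;>
      exact cos_third_pos (by linarith) (by linarith)

lemma progress_lt_of_rises (n : ℕ) {j : ℤ} (h : Rises (c n) (j - heading c n)) {x y : ℝ}
    (hx0 : 0 ≤ x) (hxy : x < y) (hy2 : y ≤ 2) :
    progress (bumpTrain c) (Real.pi / 3 * j) (2 * n + x)
      < progress (bumpTrain c) (Real.pi / 3 * j) (2 * n + y) := by
  rw [← sub_pos, progress_sub_arc c n _ hx0 hxy.le hy2]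
  refine intervalIntegral.intervalIntegral_pos_of_pos_on ?_ ?_ hxy
  · have := continuous_bumpPrimitive
    exact Continuous.intervalIntegrable (by fun_prop) _ _
  · intro t ht
    rw [intCast_arcIntegrand]
    exact h.cos_pos (bumpPrimitive_nonneg (by linarith [ht.1]))
      (bumpPrimitive_le_one (by linarith [ht.2]))

/-- Consecutive arcs meet only in their common point. -/
lemma curveOf_ne_of_consecutive (hc : ∀ n, c n = 1 ∨ c n = -1 ∨ c n = -2 ∨ c n = 3) {n : ℕ} {j : ℤ}
    (h : ConsecutiveSeparatedIn c n j) {x y : ℝ} (hx0 : 0 ≤ x) (hx2 : x < 2) (hy0 : 0 ≤ y)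
    (hy2 : y < 2) :
    curveOf (bumpTrain c) (2 * n + x) ≠ curveOf (bumpTrain c) (2 * (n + 1 : ℕ) + y) := by
  intro he
  have hmid : (2 : ℝ) * n + 2 = 2 * (n + 1 : ℕ) := by push_cast; ring
  have hp := progress_eq_of_curveOf_eq (continuous_bumpTrain c) he (Real.pi / 3 * j)
  have a2 := progress_arc c j (n + 1) hy0 hy2.le
  push_cast [hmid] at a2 hp
  rcases h with ⟨h1, h2⟩ | ⟨h1, h2⟩
  -- The first arc is strictly below the joint before reaching it, and the next one never falls
  -- below the joint.
  · have a1 := progress_lt_of_rises n h1 hx0 hx2 le_rfl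
    rw [hmid] at a1
    have a3 := ((arcRange_holds (hc (n + 1)) (j - heading c (n + 1))).2 y hy0 hy2.le).1
    rw [h2, LinForm.eval_zero] at a3
    push_cast at a1
    linarith
  -- Now the first arc never exceeds the joint and the next rises strictly from it. At $y=0$ the
  -- point is the joint, which belongs to the first arc.
  · rcases hy0.eq_or_lt with rfl | hy
    · rw [add_zero, ← hmid] at he
      exact curveOf_ne_of_same_arc hc n hx0 hx2 le_rfl he
    · have a1 := progress_lt_of_rises (n + 1) h2 le_rfl hy hy2.le
      rw [add_zero] at a1
      obtain ⟨b1, b2⟩ := arcRange_holds (hc n) (j - heading c n)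
      have a3 := (b2 x hx0 hx2.le).2
      rw [h1, b1] at a3
      have a4 := progress_arc c j n hx0 hx2.le
      have a5 := progress_arc c j n zero_le_two le_rfl
      rw [hmid] at a5
      push_cast at a1 a5
      linarith

lemma SeparatedIn.progress_lt (hc : ∀ n, c n = 1 ∨ c n = -1 ∨ c n = -2 ∨ c n = 3) {m n : ℕ} {j : ℤ}
    (h : SeparatedIn c m n j) {x y : ℝ} (hx0 : 0 ≤ x) (hx2 : x ≤ 2) (hy0 : 0 ≤ y) (hy2 : y ≤ 2) :
    progress (bumpTrain c) (Real.pi / 3 * j) (2 * m + x)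
      < progress (bumpTrain c) (Real.pi / 3 * j) (2 * n + y) := by
  have h1 := LinForm.eval_pos h
  rw [LinForm.eval_sub, LinForm.eval_add, LinForm.eval_add] at h1
  rw [progress_arc c j m hx0 hx2, progress_arc c j n hy0 hy2, progress_eq_position hc,
    progress_eq_position hc]
  have h2 := ((arcRange_holds (hc m) (j - heading c m)).2 x hx0 hx2).2
  have h3 := ((arcRange_holds (hc n) (j - heading c n)).2 y hy0 hy2).1
  linarith

namespace SimpleClosedTrain

variable (h : SimpleClosedTrain c)
include h

lemma curveOf_end : curveOf (bumpTrain c) 48 0 = 0 ∧ curveOf (bumpTrain c) 48 1 = 0 := by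
  have e0 := progress_eq_position h.mem 0 24
  have e1 := progress_eq_position h.mem 1 24
  rw [h.position_end.1, LinForm.eval_zero, progress_eq (continuous_bumpTrain c)] at e0
  rw [h.position_end.2, LinForm.eval_zero, progress_eq (continuous_bumpTrain c)] at e1
  norm_num at e0 e1
  rw [e0, mul_zero, zero_add, mul_eq_zero] at e1
  exact ⟨e0, e1.resolve_left (by positivity)⟩

lemma bumpTrain_periodic (s : ℝ) : bumpTrain c s = bumpTrain c (s + 48) := by
  have := bumpTrain_shift (m := 24) h.periodic s
  norm_num at this
  exact this

lemma turning_end : turning (bumpTrain c) 48 = 2 * Real.pi := by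
  have e := turning_bumpTrain c 24 (x := 0) le_rfl zero_le_two
  rw [h.heading_end] at e
  norm_num at e
  rw [e]
  ring

lemma curveOf_periodic : Function.Periodic (curveOf (bumpTrain c)) 48 := by
  intro s
  have hκ := continuous_bumpTrain c
  have e0 := curveOf_add_zero_apply hκ hκ h.bumpTrain_periodic s
  have e1 := curveOf_add_one_apply hκ hκ h.bumpTrain_periodic s
  rw [h.turning_end, h.curveOf_end.1, Real.cos_two_pi, Real.sin_two_pi] at e0
  rw [h.turning_end, h.curveOf_end.2, Real.cos_two_pi, Real.sin_two_pi] at e1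
  ext i
  fin_cases i
  · simpa using e0
  · simpa using e1

lemma curveOf_ne_of_arc_lt {m n : ℕ} (hmn : m < n) (hn : n < 24) {x y : ℝ} (hx0 : 0 ≤ x)
    (hx2 : x < 2) (hy0 : 0 ≤ y) (hy2 : y < 2) :
    curveOf (bumpTrain c) (2 * m + x) ≠ curveOf (bumpTrain c) (2 * n + y) := by
  have hκ := continuous_bumpTrain c
  rcases (by omega : n = m + 1 ∨ (m = 0 ∧ n = 23) ∨ (2 ≤ n - m ∧ n - m ≤ 22))
    with rfl | ⟨rfl, rfl⟩ | ⟨h1, h2⟩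
  · obtain ⟨j, -, hj⟩ := h.consecutive m (by omega)
    exact curveOf_ne_of_consecutive h.mem hj hx0 hx2 hy0 hy2
  -- The last and the first arc are neighbours: arc 0 coincides with arc 24 by periodicity.
  · obtain ⟨j, -, hj⟩ := h.consecutive 23 (by omega)
    intro he
    refine curveOf_ne_of_consecutive h.mem hj hy0 hy2 hx0 hx2 ?_
    rw [← he, ← h.curveOf_periodic]
    congr 1
    push_cast
    ring
  · obtain ⟨j, -, hj⟩ := h.separated n hn m hmn h1 h2
    intro he
    have hp := progress_eq_of_curveOf_eq hκ he (Real.pi / 3 * (j : ℕ))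
    rcases hj with hj | hj
    · exact (hj.progress_lt h.mem hx0 hx2.le hy0 hy2.le).ne (by exact_mod_cast hp)
    · exact (hj.progress_lt h.mem hy0 hy2.le hx0 hx2.le).ne' (by exact_mod_cast hp)

lemma curveOf_injOn : InjOn (curveOf (bumpTrain c)) (Ico 0 48) := by
  have key : ∀ s t : ℝ, 0 ≤ s → s < t → t < 48 →
      curveOf (bumpTrain c) s ≠ curveOf (bumpTrain c) t := by
    intro s t hs hst ht
    obtain ⟨m, x, hx0, hx2, rfl⟩ := exists_eq_two_mul_add s
    obtain ⟨n, y, hy0, hy2, rfl⟩ := exists_eq_two_mul_add t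
    have hm : 0 ≤ m := by
      have : (-1 : ℝ) < m := by linarith
      have : -1 < m := by exact_mod_cast this
      omega
    have hn : n < 24 := by
      have : (n : ℝ) < 24 := by linarith
      exact_mod_cast this
    have hmn : m ≤ n := by
      have : (m : ℝ) < n + 1 := by linarith
      have : m < n + 1 := by exact_mod_cast this
      omega
    lift m to ℕ using hm
    lift n to ℕ using (by omega)
    simp only [Int.cast_natCast] at *
    rcases (by omega : m = n ∨ m < n) with rfl | hlt
    · exact curveOf_ne_of_same_arc h.mem m hx0 (by linarith) hy2.le
    · exact h.curveOf_ne_of_arc_lt hlt (by omega) hx0 hx2 hy0 hy2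
  intro s hs t ht he
  rcases lt_trichotomy s t with hlt | heq | hgt
  · exact absurd he (key s t hs.1 hlt ht.2)
  · exact heq
  · exact absurd he.symm (key t s ht.1 hgt hs.2)

end SimpleClosedTrain
end Train

/-! ## Differential geometry of the curve with given curvature -/

lemma hasDerivAt_plane {f : ℝ → Plane} {f' : Plane} {t : ℝ}
    (h0 : HasDerivAt (fun t => f t 0) (f' 0) t) (h1 : HasDerivAt (fun t => f t 1) (f' 1) t) :
    HasDerivAt f f' t := by
  have h : HasDerivAt (fun t => (fun i => f t i : Fin 2 → ℝ)) (fun i => f' i) t :=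
    hasDerivAt_pi.2 fun i => by
      fin_cases i
      · exact h0
      · exact h1
  exact (PiLp.continuousLinearEquiv 2 ℝ (fun _ : Fin 2 => ℝ)).symm.hasFDerivAt.comp_hasDerivAt t h

section Curve

variable {κ : ℝ → ℝ}

lemma hasDerivAt_curveOf (hκ : Continuous κ) (s : ℝ) :
    HasDerivAt (curveOf κ) !₂[Real.cos (turning κ s), Real.sin (turning κ s)] s := by
  have c := continuous_turning hκ
  have c1 : Continuous fun t => Real.cos (turning κ t) := by fun_prop
  have c2 : Continuous fun t => Real.sin (turning κ t) := by fun_prop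
  exact hasDerivAt_plane
    (intervalIntegral.integral_hasDerivAt_right (c1.intervalIntegrable 0 s)
      (c1.stronglyMeasurableAtFilter _ _) c1.continuousAt)
    (intervalIntegral.integral_hasDerivAt_right (c2.intervalIntegrable 0 s)
      (c2.stronglyMeasurableAtFilter _ _) c2.continuousAt)

lemma deriv_curveOf (hκ : Continuous κ) :
    deriv (curveOf κ) = fun s => !₂[Real.cos (turning κ s), Real.sin (turning κ s)] :=
  funext fun s => (hasDerivAt_curveOf hκ s).deriv

lemma norm_deriv_curveOf (hκ : Continuous κ) (s : ℝ) : ‖deriv (curveOf κ) s‖ = 1 := by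
  rw [deriv_curveOf hκ, EuclideanSpace.norm_eq, Fin.sum_univ_two]
  simp

lemma iteratedDeriv_two_curveOf (hκ : Continuous κ) (s : ℝ) :
    iteratedDeriv 2 (curveOf κ) s
      = !₂[-Real.sin (turning κ s) * κ s, Real.cos (turning κ s) * κ s] := by
  rw [iteratedDeriv_succ, iteratedDeriv_one, deriv_curveOf hκ]
  exact (hasDerivAt_plane (hasDerivAt_turning hκ s).cos (hasDerivAt_turning hκ s).sin).deriv

lemma curvature_curveOf (hκ : Continuous κ) (s : ℝ) : curvature (curveOf κ) s = κ s := by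
  unfold curvature
  rw [norm_deriv_curveOf hκ, iteratedDeriv_two_curveOf hκ, deriv_curveOf hκ]
  simp only [det2, Matrix.cons_val_zero, Matrix.cons_val_one, one_pow, div_one]
  linear_combination κ s * Real.sin_sq_add_cos_sq (turning κ s)

lemma curvatureDot_curveOf (hκ : Continuous κ) (s : ℝ) :
    curvatureDot (curveOf κ) s = deriv κ s := by
  unfold curvatureDot
  rw [norm_deriv_curveOf hκ, div_one, funext (curvature_curveOf hκ)]

lemma signatureMap_curveOf (hκ : Continuous κ) (s : ℝ) :
    signatureMap (curveOf κ) s = (κ s, deriv κ s) := by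
  unfold signatureMap
  rw [curvature_curveOf hκ, curvatureDot_curveOf hκ]

lemma contDiff_turning (hκ : ContDiff ℝ ∞ κ) : ContDiff ℝ ∞ (turning κ) := by
  rw [contDiff_infty_iff_deriv]
  have h := hasDerivAt_turning hκ.continuous
  refine ⟨fun s => (h s).differentiableAt, ?_⟩
  rwa [funext fun s => (h s).deriv]

lemma contDiff_curveOf (hκ : ContDiff ℝ ∞ κ) : ContDiff ℝ ∞ (curveOf κ) := by
  rw [contDiff_infty_iff_deriv]
  refine ⟨fun s => (hasDerivAt_curveOf hκ.continuous s).differentiableAt, ?_⟩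
  rw [deriv_curveOf hκ.continuous, contDiff_euclidean]
  intro i
  have h := contDiff_turning hκ
  fin_cases i
  · exact Real.contDiff_cos.comp h
  · exact Real.contDiff_sin.comp h

end Curve

/-! ## Simple closed curves -/

/-- Smooth unit speed parametrizations of simple closed curves of length `L`. -/
structure SimpleLoop (L : ℝ) (γ : ℝ → Plane) : Prop where
  pos : 0 < L
  contDiff : ContDiff ℝ ∞ γ
  unitSpeed : IsUnitSpeed γ
  periodic : Function.Periodic γ L
  injOn : InjOn γ (Ico 0 L)

namespace SimpleLoop

variable {L : ℝ} {γ : ℝ → Plane}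

lemma eq_iff (h : SimpleLoop L γ) (s t : ℝ) : γ s = γ t ↔ (s : AddCircle L) = t := by
  have hL : Fact (0 < L) := ⟨h.pos⟩
  have key : ∀ s, γ s = γ (toIcoMod h.pos 0 s) := fun s => by
    rw [toIcoMod, h.periodic.sub_zsmul_eq]
  constructor
  · intro he
    rw [key s, key t] at he
    have := h.injOn (by simpa using toIcoMod_mem_Ico h.pos 0 s)
      (by simpa using toIcoMod_mem_Ico h.pos 0 t) he
    have e : ∀ s, ((toIcoMod h.pos 0 s : ℝ) : AddCircle L) = s := fun s => by
      rw [toIcoMod, AddCircle.coe_sub, AddCircle.coe_zsmul, AddCircle.coe_period, zsmul_zero,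
        sub_zero]
    rw [← e s, ← e t, this]
  · intro he
    rw [← h.periodic.lift_coe s, ← h.periodic.lift_coe t]
    exact congrArg _ he

lemma eq_iff_exists (h : SimpleLoop L γ) (s t : ℝ) : γ s = γ t ↔ ∃ n : ℤ, t = s + n * L := by
  rw [h.eq_iff, eq_comm, ← sub_eq_zero, ← AddCircle.coe_sub, AddCircle.coe_eq_zero_iff]
  constructor
  · rintro ⟨n, hn⟩
    exact ⟨n, by rw [zsmul_eq_mul] at hn; linarith⟩
  · rintro ⟨n, hn⟩
    exact ⟨n, by rw [zsmul_eq_mul]; linarith⟩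

/-- The circle is compact, so a continuous injection into the plane is an embedding. -/
lemma isClosedEmbedding_lift (h : SimpleLoop L γ) :
    IsClosedEmbedding (h.periodic.lift : AddCircle L → Plane) := by
  have hL : Fact (0 < L) := ⟨h.pos⟩
  refine Continuous.isClosedEmbedding ?_ ?_
  · exact continuous_coinduced_dom.2 h.contDiff.continuous
  · intro x y
    induction x using QuotientAddGroup.induction_on
    induction y using QuotientAddGroup.induction_on
    exact (h.eq_iff _ _).1

lemma range_lift (h : SimpleLoop L γ) :
    range (h.periodic.lift : AddCircle L → Plane) = range γ := by
  ext p
  constructor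
  · rintro ⟨x, rfl⟩
    induction x using QuotientAddGroup.induction_on with
    | H s => exact ⟨s, rfl⟩
  · rintro ⟨s, rfl⟩
    exact ⟨s, rfl⟩

lemma isMinimalPeriod (h : SimpleLoop L γ) : IsMinimalPeriod γ L := by
  refine ⟨h.pos, h.periodic, fun T hT hper => ?_⟩
  have h0 : γ 0 = γ T := by
    have := hper 0
    rw [zero_add] at this
    exact this.symm
  obtain ⟨n, hn⟩ := (h.eq_iff_exists 0 T).1 h0
  rw [zero_add] at hn
  have h1 : (0 : ℝ) < n := pos_of_mul_pos_left (hn ▸ hT) h.pos.le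
  have h2 : (1 : ℝ) ≤ n := by
    have : 0 < n := by exact_mod_cast h1
    exact_mod_cast this
  rw [hn]
  nlinarith [h.pos]

/-- A local coordinate of the curve around a point, defined on the whole line. -/
lemma isOpenEmbedding_chart (h : SimpleLoop L γ) (t : ℝ) :
    IsOpenEmbedding fun x : ℝ => ((t + L / Real.pi * Real.arctan x : ℝ) : AddCircle L) := by
  have hL : Fact (0 < L) := ⟨h.pos⟩
  have hpi := Real.pi_pos
  have hLp := h.pos
  refine IsOpenEmbedding.of_continuous_injective_isOpenMap ?_ ?_ ?_
  · have := Real.continuous_arctan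
    exact (AddCircle.continuous_mk' L).comp (by fun_prop)
  · intro x y hxy
    have b : ∀ z, t + L / Real.pi * Real.arctan z ∈ Ico (t - L / 2) (t - L / 2 + L) := by
      intro z
      have e : L / 2 = L / Real.pi * (Real.pi / 2) := by field_simp
      have h1 := mul_lt_mul_of_pos_left (Real.neg_pi_div_two_lt_arctan z)
        (show 0 < L / Real.pi by positivity)
      have h2 := mul_lt_mul_of_pos_left (Real.arctan_lt_pi_div_two z)
        (show 0 < L / Real.pi by positivity)
      constructor <;> linarith
    have := (AddCircle.coe_eq_coe_iff_of_mem_Ico (b x) (b y)).1 hxy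
    have h3 : L / Real.pi * Real.arctan x = L / Real.pi * Real.arctan y := by linarith
    exact Real.arctan_injective (mul_left_cancel₀ (by positivity) h3)
  · have h1 : IsOpenMap Real.arctan :=
      Real.coe_tanPartialHomeomorph_symm ▸
        (Real.tanPartialHomeomorph.symm.isOpenEmbedding rfl).isOpenMap
    have h2 : IsOpenMap fun y : ℝ => t + L / Real.pi * y :=
      ((Homeomorph.mulLeft₀ (L / Real.pi) (by positivity)).trans (Homeomorph.addLeft t)).isOpenMap
    exact QuotientAddGroup.isOpenMap_coe.comp (h2.comp h1)

/-- A circle minus a point is an open arc homeomorphic to $\mathbb R$ (through arctan), and an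
embedding makes it the trace on the curve of an open set of the plane. -/
lemma isSimple (h : SimpleLoop L γ) : IsSimple γ := by
  rintro p ⟨t, rfl⟩
  refine ⟨⟨t, rfl⟩, ?_⟩
  have e1 := h.isOpenEmbedding_chart t
  have e2 := h.isClosedEmbedding_lift
  obtain ⟨U, hU, hUeq⟩ := e2.isInducing.isOpen_iff.1 e1.isOpen_range
  have e3 := e2.isEmbedding.comp e1.isEmbedding
  have hr : range ((h.periodic.lift : AddCircle L → Plane) ∘
      fun x : ℝ => ((t + L / Real.pi * Real.arctan x : ℝ) : AddCircle L)) = range γ ∩ U := by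
    rw [range_comp, ← hUeq, image_preimage_eq_inter_range, h.range_lift, inter_comm]
  have ht : γ t ∈ range γ ∩ U := by
    rw [← hr]
    exact ⟨0, by simp⟩
  refine ⟨U, hU, ht.2, Or.inl ⟨?_⟩⟩
  rw [← hr]
  exact e3.toHomeomorph.symm

end SimpleLoop

lemma SimpleClosedTrain.simpleLoop {c : ℤ → ℤ} (h : SimpleClosedTrain c) :
    SimpleLoop 48 (curveOf (bumpTrain c)) where
  pos := by norm_num
  contDiff := contDiff_curveOf (contDiff_bumpTrain c)
  unitSpeed := norm_deriv_curveOf (continuous_bumpTrain c)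
  periodic := h.curveOf_periodic
  injOn := h.curveOf_injOn

/-! ## Rigid motions of simple closed curves -/

/-- The slope of $h\circ u$ is the slope of $u$ times a difference quotient of $h$ that tends to 1,
so one may divide. Using `dslope` covers the points where $u(s)=u(t)$. -/
lemma hasDerivAt_one_of_comp {h u : ℝ → ℝ} {t : ℝ} (hh : HasDerivAt h 1 (u t))
    (hk : HasDerivAt (fun s => h (u s)) 1 t) (hu : ContinuousAt u t) : HasDerivAt u 1 t := by
  rw [hasDerivAt_iff_tendsto_slope] at hk ⊢
  have hq : Tendsto (fun s => dslope h (u t) (u s)) (𝓝[≠] t) (𝓝 1) := by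
    have c1 : ContinuousAt (dslope h (u t)) (u t) :=
      continuousAt_dslope_same.2 hh.differentiableAt
    have c2 : ContinuousAt (fun s => dslope h (u t) (u s)) t :=
      ContinuousAt.comp (f := u) (g := dslope h (u t)) c1 hu
    have c3 := c2.tendsto
    rw [dslope_same, hh.deriv] at c3
    exact c3.mono_left nhdsWithin_le_nhds
  have e := hk.div hq one_ne_zero
  rw [div_one] at e
  refine e.congr' ?_
  filter_upwards [hq.eventually_ne one_ne_zero] with s hs
  rw [Pi.div_apply, div_eq_iff hs]
  have e1 := sub_smul_dslope h (u t) (u s)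
  rw [smul_eq_mul] at e1
  simp only [slope_def_field]
  rw [← e1]
  ring

lemma isometry_apply (g : Plane ≃ᵃⁱ[ℝ] Plane) (x : Plane) :
    g x = g.linearIsometryEquiv x + g 0 := by
  have := g.map_vadd 0 x
  simpa using this

lemma hasDerivAt_isometry_comp (g : Plane ≃ᵃⁱ[ℝ] Plane) {f : ℝ → Plane} {f' : Plane} {t : ℝ}
    (hf : HasDerivAt f f' t) : HasDerivAt (fun s => g (f s)) (g.linearIsometryEquiv f') t := by
  rw [show (fun s => g (f s)) = fun s => g.linearIsometryEquiv (f s) + g 0 from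
    funext fun s => isometry_apply g (f s)]
  have h := (g.linearIsometryEquiv.toContinuousLinearEquiv.hasFDerivAt.comp_hasDerivAt t hf)
  exact h.add_const (g 0)

namespace SimpleLoop

variable {L : ℝ} {γ γ₁ γ₂ : ℝ → Plane}

lemma hasDerivAt (h : SimpleLoop L γ) (t : ℝ) : HasDerivAt γ (deriv γ t) t :=
  (h.contDiff.differentiable (by simp) t).hasDerivAt

lemma deriv_add_int_mul (h : SimpleLoop L γ) (t : ℝ) (n : ℤ) :
    deriv γ (t + n * L) = deriv γ t := by
  rw [← deriv_comp_add_const]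
  congr 1
  funext s
  exact h.periodic.int_mul n s

lemma mem_orientation_iff (h : SimpleLoop L γ) (x : Plane × Plane) :
    x ∈ orientation γ ↔ ∃ t, x = (γ t, deriv γ t) := by
  unfold orientation
  constructor
  · rintro ⟨t, -, ht⟩
    exact ⟨t, by rw [ht, h.unitSpeed t, inv_one, one_smul]⟩
  · rintro ⟨t, ht⟩
    exact ⟨t, h.isSimple _ ⟨t, rfl⟩, by rw [ht, h.unitSpeed t, inv_one, one_smul]⟩

/-- An isometry that maps one oriented curve onto another one matches the arc-length
parametrizations up to a shift. -/
theorem exists_shift_of_mapsOnto (h₁ : SimpleLoop L γ₁) (h₂ : SimpleLoop L γ₂)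
    {g : Plane ≃ᵃⁱ[ℝ] Plane} (hg : MapsOnto g γ₁ γ₂) : ∃ c, ∀ t, g (γ₁ t) = γ₂ (t + c) := by
  have e2 := h₂.isClosedEmbedding_lift
  have hφ : ∀ t, ∃ y : AddCircle L, h₂.periodic.lift y = g (γ₁ t) := by
    intro t
    have : g (γ₁ t) ∈ range (h₂.periodic.lift : AddCircle L → Plane) := by
      rw [h₂.range_lift, ← hg.1]
      exact ⟨_, ⟨t, rfl⟩, rfl⟩
    exact this
  choose φ hφ using hφ
  have cφ : Continuous φ := by
    rw [e2.isInducing.continuous_iff]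
    exact (g.continuous.comp h₁.contDiff.continuous).congr fun t => (hφ t).symm
  obtain ⟨u0, hu0⟩ := QuotientAddGroup.mk_surjective (φ 0)
  -- The image point, read as an element of the parameter circle, depends continuously on $t$ and
  -- lifts to a real parameter $u(t)$.
  obtain ⟨u, ⟨-, hu⟩, -⟩ := (AddCircle.isCoveringMap_coe L).existsUnique_continuousMap_lifts
    ⟨φ, cφ⟩ 0 u0 hu0
  have hγ : ∀ t, γ₂ (u t) = g (γ₁ t) := by
    intro t
    rw [← hφ t, ← show ((u t : ℝ) : AddCircle L) = φ t from congrFun hu t]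
    rfl
  have htan : ∀ t, deriv γ₂ (u t) = g.linearIsometryEquiv (deriv γ₁ t) := by
    intro t
    have hmem : tangentAction g (γ₁ t, deriv γ₁ t) ∈ orientation γ₂ := by
      rw [← hg.2]
      exact ⟨_, (h₁.mem_orientation_iff _).2 ⟨t, rfl⟩, rfl⟩
    obtain ⟨v, hv⟩ := (h₂.mem_orientation_iff _).1 hmem
    obtain ⟨hv1, hv2⟩ := Prod.ext_iff.1 hv
    change g (γ₁ t) = γ₂ v at hv1
    change g.linearIsometryEquiv (deriv γ₁ t) = deriv γ₂ v at hv2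
    rw [← hγ t] at hv1
    obtain ⟨n, rfl⟩ := (h₂.eq_iff_exists _ _).1 hv1
    rw [hv2, h₂.deriv_add_int_mul]
  have hu' : ∀ t, HasDerivAt u 1 t := by
    intro t
    -- Pairing with the common unit tangent turns $\gamma_2\circ u=g\circ\gamma_1$ into a scalar
    -- identity with both derivatives 1. Agreement of orientations excludes $u'=-1$.
    have n1 : inner ℝ (deriv γ₂ (u t)) (deriv γ₂ (u t)) = 1 := by
      rw [real_inner_self_eq_norm_sq, h₂.unitSpeed, one_pow]
    have d : ∀ {f : ℝ → Plane} {f' : Plane} {s : ℝ} (p : Plane), HasDerivAt f f' s →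
        HasDerivAt (fun x => inner ℝ p (f x)) (inner ℝ p f') s := fun p hf =>
      (innerSL ℝ p).hasFDerivAt.comp_hasDerivAt _ hf
    have d1 := d (deriv γ₂ (u t)) (h₂.hasDerivAt (u t))
    have d2 := d (deriv γ₂ (u t)) (hasDerivAt_isometry_comp g (h₁.hasDerivAt t))
    rw [← htan t, n1] at d2
    rw [n1] at d1
    simp only [← hγ] at d2
    exact hasDerivAt_one_of_comp d1 d2 u.continuous.continuousAt
  refine ⟨u 0, fun t => ?_⟩
  have hconst : ∀ s, HasDerivAt (fun s => u s - s) 0 s := fun s => by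
    have := (hu' s).sub (hasDerivAt_id s)
    rwa [sub_self] at this
  have := is_const_of_deriv_eq_zero (fun s => (hconst s).differentiableAt)
    (fun s => (hconst s).deriv) t 0
  rw [sub_zero] at this
  rw [← hγ t, ← this, add_sub_cancel]

lemma mapsOnto_of_shift (h₁ : SimpleLoop L γ₁) (h₂ : SimpleLoop L γ₂) {g : Plane ≃ᵃⁱ[ℝ] Plane}
    {c : ℝ} (hg : ∀ t, g (γ₁ t) = γ₂ (t + c)) : MapsOnto g γ₁ γ₂ := by
  have hd : ∀ t, g.linearIsometryEquiv (deriv γ₁ t) = deriv γ₂ (t + c) := by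
    intro t
    have := (hasDerivAt_isometry_comp g (h₁.hasDerivAt t)).deriv
    rw [← this, funext hg, deriv_comp_add_const]
  constructor
  · ext p
    constructor
    · rintro ⟨_, ⟨t, rfl⟩, rfl⟩
      exact ⟨t + c, (hg t).symm⟩
    · rintro ⟨t, rfl⟩
      exact ⟨_, ⟨t - c, rfl⟩, by rw [hg, sub_add_cancel]⟩
  · ext x
    rw [h₂.mem_orientation_iff]
    constructor
    · rintro ⟨y, hy, rfl⟩
      obtain ⟨t, rfl⟩ := (h₁.mem_orientation_iff y).1 hy
      exact ⟨t + c, Prod.ext (hg t) (hd t)⟩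
    · rintro ⟨t, rfl⟩
      refine ⟨(γ₁ (t - c), deriv γ₁ (t - c)), (h₁.mem_orientation_iff _).2 ⟨_, rfl⟩, ?_⟩
      refine Prod.ext ?_ ?_
      · exact (hg _).trans (by rw [sub_add_cancel])
      · exact (hd _).trans (by rw [sub_add_cancel])

end SimpleLoop

/-! ## Curvature and rigid motions -/

lemma det2_map (f : Plane →ₗ[ℝ] Plane) (v w : Plane) :
    det2 (f v) (f w) = LinearMap.det f * det2 v w := by
  set b := (EuclideanSpace.basisFun (Fin 2) ℝ).toBasis with hb
  have h : ∀ (v : Plane) i, f v i = (LinearMap.toMatrix b b f).mulVec (fun j => v j) i := by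
    intro v i
    have := congrFun (LinearMap.toMatrix_mulVec_repr b b f v) i
    have e : ⇑(b.repr v) = fun j => v j := by
      funext j
      simp [hb]
    rw [e] at this
    rw [this]
    simp [hb]
  rw [← LinearMap.det_toMatrix b, Matrix.det_fin_two]
  unfold det2
  rw [h v 0, h v 1, h w 0, h w 1]
  simp only [Matrix.mulVec, dotProduct, Fin.sum_univ_two]
  ring

lemma det2_of_mem_SE2 {g : Plane ≃ᵃⁱ[ℝ] Plane} (hg : g ∈ SE2) (v w : Plane) :
    det2 (g.linearIsometryEquiv v) (g.linearIsometryEquiv w) = det2 v w := by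
  have h := det2_map (g.linearIsometryEquiv.toLinearEquiv : Plane →ₗ[ℝ] Plane) v w
  rw [show LinearMap.det (g.linearIsometryEquiv.toLinearEquiv : Plane →ₗ[ℝ] Plane) = 1 from hg,
    one_mul] at h
  exact h

lemma curvature_isometry_comp {g : Plane ≃ᵃⁱ[ℝ] Plane} (hg : g ∈ SE2) {γ : ℝ → Plane}
    (hγ : ContDiff ℝ ∞ γ) (t : ℝ) : curvature (fun s => g (γ s)) t = curvature γ t := by
  have d1 : deriv (fun s => g (γ s)) = fun s => g.linearIsometryEquiv (deriv γ s) :=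
    funext fun s => (hasDerivAt_isometry_comp g
      (hγ.differentiable (by simp) s).hasDerivAt).deriv
  have d2 : Differentiable ℝ (deriv γ) :=
    ((contDiff_infty_iff_deriv.1 hγ).2).differentiable (by simp)
  have d3 : deriv (fun s => g.linearIsometryEquiv (deriv γ s)) t
      = g.linearIsometryEquiv (deriv (deriv γ) t) :=
    (g.linearIsometryEquiv.toContinuousLinearEquiv.hasFDerivAt.comp_hasDerivAt t
      (d2 t).hasDerivAt).deriv
  unfold curvature
  rw [iteratedDeriv_succ, iteratedDeriv_one, iteratedDeriv_succ, iteratedDeriv_one, d1, d3,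
    det2_of_mem_SE2 hg, LinearIsometryEquiv.norm_map]

lemma curvature_shift (γ : ℝ → Plane) (c t : ℝ) :
    curvature (fun s => γ (s + c)) t = curvature γ (t + c) := by
  have d1 : deriv (fun s => γ (s + c)) = fun s => deriv γ (s + c) :=
    funext fun s => deriv_comp_add_const γ c s
  unfold curvature
  rw [iteratedDeriv_succ, iteratedDeriv_one, iteratedDeriv_succ, iteratedDeriv_one, d1,
    deriv_comp_add_const]

/-- Rotation of the plane. -/
def planeRotation (a : ℝ) : Plane ≃ₗᵢ[ℝ] Plane :=
  (Complex.orthonormalBasisOneI.repr.symm.trans (rotation (Circle.exp a))).trans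
    Complex.orthonormalBasisOneI.repr

lemma planeRotation_apply (a : ℝ) (v : Plane) :
    planeRotation a v = !₂[Real.cos a * v 0 - Real.sin a * v 1,
      Real.sin a * v 0 + Real.cos a * v 1] := by
  ext i
  fin_cases i <;>
  simp [planeRotation, rotation_apply, Complex.exp_ofReal_mul_I_re, Complex.exp_ofReal_mul_I_im]
  ring

lemma det_planeRotation (a : ℝ) :
    LinearMap.det ((planeRotation a).toLinearEquiv : Plane →ₗ[ℝ] Plane) = 1 := by
  have h := LinearMap.det_conj ((rotation (Circle.exp a)).toLinearEquiv : ℂ →ₗ[ℝ] ℂ)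
    Complex.orthonormalBasisOneI.repr.toLinearEquiv
  rw [det_rotation] at h
  exact h

/-- The rigid motion `x ↦ v + R x`, where `R` is the rotation of angle `a`. -/
def rigidMotion (a : ℝ) (v : Plane) : Plane ≃ᵃⁱ[ℝ] Plane :=
  (planeRotation a).toAffineIsometryEquiv.trans (AffineIsometryEquiv.constVAdd ℝ Plane v)

lemma rigidMotion_apply (a : ℝ) (v x : Plane) : rigidMotion a v x = v + planeRotation a x := rfl

lemma rigidMotion_mem_SE2 (a : ℝ) (v : Plane) : rigidMotion a v ∈ SE2 := by
  have h : (rigidMotion a v).linearIsometryEquiv = planeRotation a := by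
    ext x : 1
    have h1 := isometry_apply (rigidMotion a v) x
    rw [rigidMotion_apply, rigidMotion_apply, map_zero, add_zero, add_comm] at h1
    exact (add_right_cancel h1).symm
  change LinearMap.det ((rigidMotion a v).linearIsometryEquiv.toLinearEquiv : Plane →ₗ[ℝ] Plane) = 1
  rw [h, det_planeRotation]

lemma rigidMotion_curveOf {κ κ' : ℝ → ℝ} (hκ : Continuous κ) (hκ' : Continuous κ') {c : ℝ}
    (h : ∀ t, κ t = κ' (t + c)) (t : ℝ) :
    rigidMotion (turning κ' c) (curveOf κ' c) (curveOf κ t) = curveOf κ' (t + c) := by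
  rw [rigidMotion_apply, planeRotation_apply]
  ext i
  fin_cases i
  · exact (curveOf_add_zero_apply hκ hκ' h t).symm
  · exact (curveOf_add_one_apply hκ hκ' h t).symm

/-! ## Symmetry groups -/

/-- A motion is determined by the image of one point and of one unit tangent $p$: the inner product
and `det2` with $p$ are preserved, and together they determine any vector. -/
lemma eq_of_forall_curve_eq {L : ℝ} {γ : ℝ → Plane} (h : SimpleLoop L γ)
    {g g' : Plane ≃ᵃⁱ[ℝ] Plane} (hg : g ∈ SE2) (hg' : g' ∈ SE2) (he : ∀ t, g (γ t) = g' (γ t)) :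
    g = g' := by
  set p := deriv γ 0 with hp
  have e1 : g.linearIsometryEquiv p = g'.linearIsometryEquiv p := by
    rw [← (hasDerivAt_isometry_comp g (h.hasDerivAt 0)).deriv,
      ← (hasDerivAt_isometry_comp g' (h.hasDerivAt 0)).deriv, funext he]
  have n1 : ‖g.linearIsometryEquiv p‖ = 1 := by
    rw [LinearIsometryEquiv.norm_map]
    exact h.unitSpeed 0
  have e2 : ∀ w, g.linearIsometryEquiv w = g'.linearIsometryEquiv w := by
    intro w
    have d1 := (det2_of_mem_SE2 hg p w).trans (det2_of_mem_SE2 hg' p w).symm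
    have d2 : inner ℝ (g.linearIsometryEquiv p) (g.linearIsometryEquiv w)
        = inner ℝ (g'.linearIsometryEquiv p) (g'.linearIsometryEquiv w) := by
      rw [LinearIsometryEquiv.inner_map_map, LinearIsometryEquiv.inner_map_map]
    rw [← e1] at d1 d2
    have d3 : ‖g.linearIsometryEquiv p‖ ^ 2 = 1 := by rw [n1, one_pow]
    rw [EuclideanSpace.real_norm_sq_eq, Fin.sum_univ_two] at d3
    simp only [PiLp.inner_apply, Fin.sum_univ_two, RCLike.inner_apply, conj_trivial] at d2
    unfold det2 at d1
    set q := g.linearIsometryEquiv p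
    set a := g.linearIsometryEquiv w
    set b := g'.linearIsometryEquiv w
    ext i
    fin_cases i
    · change a 0 = b 0
      linear_combination (a 0 - b 0) * (-d3) + q 0 * d2 - q 1 * d1
    · change a 1 = b 1
      linear_combination (a 1 - b 1) * (-d3) + q 1 * d2 + q 0 * d1
  ext1 x
  have e3 := he 0
  rw [isometry_apply g, isometry_apply g', e2, add_left_cancel_iff] at e3
  rw [isometry_apply g, isometry_apply g', e2, e3]

/-- The curvature of congruent curves agrees up to a shift. -/
lemma exists_shift_of_congruence {L : ℝ} {κ κ' : ℝ → ℝ} (hκ : Continuous κ) (hκ' : Continuous κ')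
    (h : SimpleLoop L (curveOf κ)) (h' : SimpleLoop L (curveOf κ')) {g : Plane ≃ᵃⁱ[ℝ] Plane}
    (hg : g ∈ SE2) (hm : MapsOnto g (curveOf κ) (curveOf κ')) :
    ∃ c, (∀ t, g (curveOf κ t) = curveOf κ' (t + c)) ∧ ∀ t, κ t = κ' (t + c) := by
  obtain ⟨c, hc⟩ := h.exists_shift_of_mapsOnto h' hm
  refine ⟨c, hc, fun t => ?_⟩
  rw [← curvature_curveOf hκ, ← curvature_curveOf hκ', ← curvature_shift,
    ← curvature_isometry_comp hg h.contDiff, funext hc]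

/-- The motion $R$ realizing the shift by $\ell$ generates, since every symmetry is a shift by a
curvature period. Its order is $N$, because a shift acts trivially exactly when it is a multiple of
$L=N\ell$. -/
theorem symmetryGroup_mulEquiv {L : ℝ} {κ : ℝ → ℝ} (hκ : Continuous κ)
    (h : SimpleLoop L (curveOf κ)) {N : ℕ} (hN : 0 < N) {ℓ : ℝ} (hL : L = N * ℓ)
    (hper : ∀ t, κ t = κ (t + ℓ)) (hmin : ∀ c, (∀ t, κ t = κ (t + c)) → ∃ k : ℤ, c = k * ℓ) :
    Nonempty (symmetryGroup (curveOf κ) ≃* Multiplicative (ZMod N)) := by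
  have hN' : (0 : ℝ) < N := by exact_mod_cast hN
  have hℓ : 0 < ℓ := pos_of_mul_pos_right (hL ▸ h.pos) hN'.le
  set R : symmetryGroup (curveOf κ) := ⟨rigidMotion (turning κ ℓ) (curveOf κ ℓ),
    rigidMotion_mem_SE2 _ _, h.mapsOnto_of_shift h (rigidMotion_curveOf hκ hκ hper)⟩ with hR
  have hR1 : ∀ t, R.1 (curveOf κ t) = curveOf κ (t + ℓ) := rigidMotion_curveOf hκ hκ hper
  have hRn : ∀ (n : ℕ) (t : ℝ), (R ^ n).1 (curveOf κ t) = curveOf κ (t + n * ℓ) := by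
    intro n
    induction n with
    | zero => intro t; simp
    | succ n ih =>
      intro t
      rw [pow_succ]
      change (R ^ n).1 (R.1 (curveOf κ t)) = _
      rw [hR1, ih]
      congr 1
      push_cast
      ring
  have hRz : ∀ (k : ℤ) (t : ℝ), (R ^ k).1 (curveOf κ t) = curveOf κ (t + k * ℓ) := by
    intro k t
    obtain ⟨n, rfl | rfl⟩ := k.eq_nat_or_neg
    · rw [zpow_natCast, hRn]
      simp
    · have e : (R ^ (-(n : ℤ))).1 ((R ^ n).1 (curveOf κ (t - n * ℓ)))
          = curveOf κ (t - n * ℓ) := by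
        change (R ^ (-(n : ℤ)) * R ^ n).1 _ = _
        rw [zpow_neg, zpow_natCast, inv_mul_cancel]
        rfl
      rw [hRn, sub_add_cancel] at e
      rw [e]
      congr 1
      push_cast
      ring
  have hgen : ∀ g, g ∈ Subgroup.zpowers R := by
    intro g
    obtain ⟨c, hc1, hc2⟩ := exists_shift_of_congruence hκ hκ h h g.2.1 g.2.2
    obtain ⟨k, rfl⟩ := hmin c hc2
    refine ⟨k, Subtype.ext (eq_of_forall_curve_eq h (R ^ k).2.1 g.2.1 fun t => ?_)⟩
    rw [hc1]
    exact hRz k t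
  have hpow : ∀ n : ℕ, R ^ n = 1 ↔ ∃ k : ℤ, (n : ℤ) = k * N := by
    intro n
    constructor
    · intro hn
      have e := hRn n 0
      rw [hn] at e
      obtain ⟨k, hk⟩ := (h.eq_iff_exists _ _).1 e
      refine ⟨k, ?_⟩
      have : (n : ℝ) * ℓ = (k * N : ℝ) * ℓ := by rw [hL] at hk; linarith
      exact_mod_cast mul_right_cancel₀ hℓ.ne' this
    · rintro ⟨k, hk⟩
      refine Subtype.ext (eq_of_forall_curve_eq h (R ^ n).2.1 SE2.one_mem fun t => ?_)
      rw [hRn]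
      change _ = curveOf κ t
      have : (n : ℝ) = k * N := by exact_mod_cast hk
      rw [eq_comm, h.eq_iff_exists]
      exact ⟨k, by rw [this, hL]; ring⟩
  have hord : orderOf R = N := by
    rw [orderOf_eq_iff hN]
    refine ⟨(hpow N).2 ⟨1, by simp⟩, fun m hm hm0 he => ?_⟩
    obtain ⟨k, hk⟩ := (hpow m).1 he
    have hdvd : N ∣ m := by
      rw [← Int.natCast_dvd_natCast, hk]
      exact Dvd.intro_left k rfl
    exact absurd (Nat.le_of_dvd hm0 hdvd) (not_le.2 hm)
  have hcyc : IsCyclic (symmetryGroup (curveOf κ)) := ⟨R, hgen⟩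
  have hcard : Nat.card (symmetryGroup (curveOf κ)) = Nat.card (Multiplicative (ZMod N)) := by
    rw [← orderOf_eq_card_of_forall_mem_zpowers hgen, hord, Nat.card_congr Multiplicative.toAdd,
      Nat.card_zmod]
  exact ⟨mulEquivOfCyclicCardEq hcard⟩

/-! ## Vertices, signatures and signature indices -/

section Train

variable {c : ℤ → ℤ}

lemma signatureMap_train (c : ℤ → ℤ) (n : ℤ) {x : ℝ} (h0 : 0 ≤ x) (h2 : x ≤ 2) :
    signatureMap (curveOf (bumpTrain c)) (2 * n + x)
      = (Real.pi / 3 * (c n * unitBump x), Real.pi / 3 * (c n * deriv unitBump x)) := by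
  rw [signatureMap_curveOf (continuous_bumpTrain c), bumpTrain_apply c n h0 h2,
    deriv_bumpTrain c n h0 h2]

lemma signature_train_subset {c c' : ℤ → ℤ} (h : ∀ n, ∃ m, c n = c' m) :
    signature (curveOf (bumpTrain c)) ⊆ signature (curveOf (bumpTrain c')) := by
  rintro _ ⟨s, rfl⟩
  obtain ⟨n, x, h0, h2, rfl⟩ := exists_eq_two_mul_add s
  obtain ⟨m, hm⟩ := h n
  refine ⟨2 * m + x, ?_⟩
  rw [signatureMap_train c n h0 h2.le, signatureMap_train c' m h0 h2.le, hm]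

namespace SimpleClosedTrain

lemma ne_zero (h : SimpleClosedTrain c) (n : ℤ) : c n ≠ 0 := by
  have := h.mem n
  omega

lemma curveOf_emod (h : SimpleClosedTrain c) (n : ℤ) (x : ℝ) :
    curveOf (bumpTrain c) (2 * (n % 24 : ℤ) + x) = curveOf (bumpTrain c) (2 * n + x) := by
  rw [h.simpleLoop.eq_iff_exists]
  refine ⟨n / 24, ?_⟩
  have : (n : ℝ) = (n % 24 : ℤ) + 24 * (n / 24 : ℤ) := by
    exact_mod_cast (Int.emod_add_mul_ediv n 24).symm
  rw [this]
  ring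

lemma vertexSet_finite (h : SimpleClosedTrain c) : (vertexSet (curveOf (bumpTrain c))).Finite := by
  refine ((Finset.range 48).finite_toSet.image fun n : ℕ => curveOf (bumpTrain c) n).subset ?_
  rintro p ⟨t, rfl, ht⟩
  rw [curvatureDot_curveOf (continuous_bumpTrain c), deriv_bumpTrain_eq_zero_iff h.ne_zero] at ht
  obtain ⟨n, rfl⟩ := ht
  refine ⟨(n % 48).toNat, ?_, ?_⟩
  · simp only [Finset.coe_range, mem_Iio]
    omega
  · change curveOf (bumpTrain c) ((n % 48).toNat : ℝ) = _
    rw [h.simpleLoop.eq_iff_exists]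
    refine ⟨n / 48, ?_⟩
    have e1 : (((n % 48).toNat : ℤ) : ℝ) = ((n % 48 : ℤ) : ℝ) := by
      rw [Int.toNat_of_nonneg (by omega)]
    have e2 : (n : ℝ) = (n % 48 : ℤ) + 48 * (n / 48 : ℤ) := by
      exact_mod_cast (Int.emod_add_mul_ediv n 48).symm
    rw [Int.cast_natCast] at e1
    rw [e1, e2]
    ring

lemma isNonDegenerate (h : SimpleClosedTrain c) : IsNonDegenerate (curveOf (bumpTrain c)) := by
  intro p hp
  have hfin := h.vertexSet_finite.subset (sdiff_subset (t := {p}))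
  refine ⟨(vertexSet (curveOf (bumpTrain c)) \ {p})ᶜ, hfin.isClosed.isOpen_compl, ?_⟩
  ext q
  simp only [mem_inter_iff, mem_compl_iff, Set.mem_sdiff, mem_singleton_iff]
  constructor
  · tauto
  · rintro rfl
    tauto

lemma encard_points (h : SimpleClosedTrain c) (v : ℤ) {x : ℝ} (h0 : 0 ≤ x) (h2 : x < 2) :
    ((fun m : ℕ => curveOf (bumpTrain c) (2 * m + x)) ''
      ((Finset.range 24).filter fun m : ℕ => c m = v : Finset ℕ)).encard
      = ((Finset.range 24).filter fun m : ℕ => c m = v).card := by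
  rw [InjOn.encard_image, encard_coe_eq_coe_finsetCard]
  intro m hm n hn he
  have b : ∀ m ∈ ((Finset.range 24).filter fun m : ℕ => c m = v),
      2 * (m : ℝ) + x ∈ Ico (0 : ℝ) 48 := by
    intro m hm
    have h3 : m < 24 := Finset.mem_range.1 (Finset.mem_filter.1 hm).1
    have h4 : (m : ℝ) + 1 ≤ 24 := by exact_mod_cast h3
    exact ⟨by positivity, by linarith⟩
  have e := h.curveOf_injOn (b m hm) (b n hn) he
  have : (m : ℝ) = n := by linarith
  exact_mod_cast this

/-- Every point has five companions at the same position on arcs of equal height, so all local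
indices are at least 6. Equality holds at a peak of height 3, whose curvature $\pi$ occurs only at
such peaks. -/
lemma signatureIndex_eq (h : SimpleClosedTrain c)
    (hcard : ∀ n, ((Finset.range 24).filter fun m : ℕ => c m = c n).card = 6)
    (hpeak : ∃ n, c n = 3) : signatureIndex (curveOf (bumpTrain c)) = 6 := by
  apply le_antisymm
  · obtain ⟨n, hn⟩ := hpeak
    refine (iInf_le _ (2 * (n : ℝ) + 1)).trans ?_
    have e := h.encard_points (c n) (x := 1) zero_le_one one_lt_two
    rw [hcard n] at e
    refine le_of_le_of_eq (encard_le_encard ?_) e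
    rintro q ⟨u, rfl, hu⟩
    obtain ⟨m, x, h0, h2, rfl⟩ := exists_eq_two_mul_add u
    rw [signatureMap_train c m h0 h2.le, signatureMap_train c n zero_le_one one_le_two,
      unitBump_one, mul_one, hn] at hu
    have e1 : (c m : ℝ) * unitBump x = (3 : ℤ) :=
      mul_left_cancel₀ (by positivity) (Prod.ext_iff.1 hu).1
    have b0 := unitBump_nonneg x
    have b1 := unitBump_le_one x
    have hm : c m = 3 := by
      rcases h.mem m with hm | hm | hm | hm <;> rw [hm] at e1 <;> push_cast at e1 <;>
        first | exact hm | (exfalso; linarith)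
    rw [hm] at e1
    push_cast at e1
    obtain rfl := eq_one_of_unitBump_eq_one (by linarith)
    refine ⟨(m % 24).toNat, ?_, ?_⟩
    · have hm' : c (m % 24) = c m := by
        have per : Function.Periodic c 24 := fun n => (h.periodic n).symm
        have := per.sub_zsmul_eq (x := m) (m / 24)
        rw [← this]
        congr 1
        rw [smul_eq_mul]
        omega
      simp only [Finset.coe_filter, Finset.mem_range, mem_ofPred_eq]
      refine ⟨by omega, ?_⟩
      rw [Int.toNat_of_nonneg (by omega), hm', hm, hn]
    · change curveOf (bumpTrain c) (2 * ((m % 24).toNat : ℝ) + 1) = _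
      rw [← h.curveOf_emod m 1, ← Int.cast_natCast, Int.toNat_of_nonneg (by omega)]
  · refine le_iInf fun t => ?_
    obtain ⟨n, x, h0, h2, rfl⟩ := exists_eq_two_mul_add t
    have e := h.encard_points (c n) h0 h2
    rw [hcard n] at e
    refine le_of_eq_of_le e.symm (encard_le_encard ?_)
    rintro q ⟨m, hm, rfl⟩
    have hm' : c m = c n := (Finset.mem_filter.1 hm).2
    have e1 := signatureMap_train c m h0 h2.le
    rw [Int.cast_natCast] at e1
    exact ⟨_, rfl, by rw [e1, signatureMap_train c n h0 h2.le, hm']⟩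

end SimpleClosedTrain
end Train

/-! ## The height sequences up to shifts -/

lemma forall_height_of_fin {P : ℤ → ℤ → Prop} {i j : Fin 4} {m : ℤ}
    (h : ∀ n : ℕ, n < 24 → P (height i n) (height j (n + m % 24))) (n : ℤ) :
    P (height i n) (height j (n + m)) := by
  have e := h (n % 24).toNat (by omega)
  rw [Int.toNat_of_nonneg (by omega), height_emod, ← height_emod j,
    show (n % 24 + m % 24) % 24 = (n + m) % 24 by omega, height_emod] at e
  exact e

lemma height_shift_emod {i j : Fin 4} {m : ℤ} (h : ∀ n, height i n = height j (n + m)) (n : ℤ) :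
    height i n = height j (n + (m % 24).toNat) := by
  rw [h n, ← height_emod j (n + (m % 24).toNat), Int.toNat_of_nonneg (by omega),
    show (n + m % 24) % 24 = (n + m) % 24 by omega, height_emod]

/-- Periods of the height sequences. -/
def heightPeriod : Fin 4 → ℕ := ![4, 4, 8, 12]

lemma heightPeriod_dvd {i : Fin 4} {m : ℤ} (h : ∀ n, height i n = height i (n + m)) :
    (heightPeriod i : ℤ) ∣ m := by
  have key : ∀ i, ∀ m < 24, (∀ n < 24, height i (n : ℕ) = height i ((n : ℕ) + (m : ℕ))) →
      heightPeriod i ∣ m := by decide +kernel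
  have h1 := key i (m % 24).toNat (by omega) fun n _ => height_shift_emod h n
  -- Needed to pass from the residue of $m$ modulo 24 back to $m$.
  have h2 : heightPeriod i ∣ 24 := (by decide : ∀ i, heightPeriod i ∣ 24) i
  have h3 : (heightPeriod i : ℤ) ∣ ((m % 24).toNat : ℤ) := by exact_mod_cast h1
  have h4 : (heightPeriod i : ℤ) ∣ 24 := by exact_mod_cast h2
  rw [Int.toNat_of_nonneg (by omega)] at h3
  exact (Int.dvd_iff_dvd_of_dvd_sub
    (h4.trans (Int.dvd_self_sub_of_emod_eq rfl))).2 h3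

lemma height_add_heightPeriod (i : Fin 4) (n : ℤ) : height i n = height i (n + heightPeriod i) := by
  refine forall_height_of_fin (P := fun a b => a = b) ?_ n
  revert i
  decide +kernel

lemma height_not_shift {i j : Fin 4} (hij : i ≠ j) (m : ℤ) :
    ¬ ∀ n, height i n = height j (n + m) := by
  have key : ∀ i j : Fin 4, i ≠ j → ∀ m < 24,
      ¬ ∀ n < 24, height i (n : ℕ) = height j ((n : ℕ) + (m : ℕ)) := by decide +kernel
  intro h
  exact key i j hij (m % 24).toNat (by omega) fun n _ => height_shift_emod h n

lemma exists_height_eq (i j : Fin 4) (n : ℤ) : ∃ m, height i n = height j m := by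
  have key : ∀ i j : Fin 4, ∀ n < 24, ∃ m < 24, height i (n : ℕ) = height j (m : ℕ) := by
    decide +kernel
  obtain ⟨m, -, hm⟩ := key i j (n % 24).toNat (by omega)
  rw [Int.toNat_of_nonneg (by omega), height_emod] at hm
  exact ⟨m, hm⟩

lemma card_height_eq (i : Fin 4) (n : ℤ) :
    ((Finset.range 24).filter fun m : ℕ => height i m = height i n).card = 6 := by
  have key : ∀ i : Fin 4, ∀ n < 24,
      ((Finset.range 24).filter fun m : ℕ => height i m = height i (n : ℕ)).card = 6 := by
    decide +kernel
  have := key i (n % 24).toNat (by omega)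
  rwa [Int.toNat_of_nonneg (by omega), height_emod] at this

lemma exists_height_eq_three (i : Fin 4) : ∃ n, height i n = 3 := by
  have key : ∀ i : Fin 4, ∃ n < 24, height i (n : ℕ) = 3 := by decide +kernel
  obtain ⟨n, -, hn⟩ := key i
  exact ⟨n, hn⟩

/-! ## The four curves -/

lemma gamma_eq (i : Fin 4) : gamma i = curveOf (bumpTrain (height i)) := by
  unfold gamma
  rw [kappa_eq_bumpTrain]

lemma isMinimalPeriod_bumpTrain_height (i : Fin 4) :
    IsMinimalPeriod (bumpTrain (height i)) (2 * heightPeriod i) := by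
  have hpos : 0 < heightPeriod i := by revert i; decide
  refine ⟨by exact_mod_cast (by omega : 0 < 2 * heightPeriod i), fun s => ?_, fun T hT hper => ?_⟩
  · have := bumpTrain_shift (height_add_heightPeriod i) s
    push_cast at this
    exact this.symm
  · obtain ⟨m, rfl, hm⟩ := exists_shift_of_bumpTrain (height_ne_zero i) (height_ne_zero i)
      fun s => (hper s).symm
    have hm0 : 0 < m := by
      have : (0 : ℝ) < m := by linarith
      exact_mod_cast this
    have : (heightPeriod i : ℝ) ≤ m := by
      exact_mod_cast Int.le_of_dvd hm0 (heightPeriod_dvd hm)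
    linarith

lemma kappa_Icc_shift (i j : Fin 4) (n : ℤ) : ∃ m : ℤ, ∀ s ∈ Icc (0 : ℝ) 2,
    kappa i (2 * n + s) = kappa j (2 * m + s) := by
  obtain ⟨m, hm⟩ := exists_height_eq i j n
  refine ⟨m, fun s hs => ?_⟩
  rw [kappa_eq_bumpTrain, kappa_eq_bumpTrain, bumpTrain_apply _ n hs.1 hs.2,
    bumpTrain_apply _ m hs.1 hs.2, hm]

lemma not_congruent_gamma {i j : Fin 4} (hij : i ≠ j) : ¬ Congruent (gamma i) (gamma j) := by
  rw [gamma_eq, gamma_eq]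
  rintro ⟨g, hg, hm⟩
  obtain ⟨c, -, hc⟩ := exists_shift_of_congruence (continuous_bumpTrain _) (continuous_bumpTrain _)
    (height_simpleClosedTrain i).simpleLoop (height_simpleClosedTrain j).simpleLoop hg hm
  obtain ⟨m, -, hm⟩ := exists_shift_of_bumpTrain (height_ne_zero i) (height_ne_zero j) hc
  exact height_not_shift hij m hm

lemma symmetryGroup_gamma (i : Fin 4) {N : ℕ} (hN : N * heightPeriod i = 24) :
    Nonempty (symmetryGroup (gamma i) ≃* Multiplicative (ZMod N)) := by
  rw [gamma_eq]
  refine symmetryGroup_mulEquiv (continuous_bumpTrain _) (height_simpleClosedTrain i).simpleLoop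
    (Nat.pos_of_ne_zero fun h => by simp [h] at hN) (ℓ := 2 * heightPeriod i) ?_ ?_ ?_
  · have : (N : ℝ) * heightPeriod i = 24 := by exact_mod_cast hN
    linarith
  · exact fun t => ((isMinimalPeriod_bumpTrain_height i).2.1 t).symm
  · intro c hc
    obtain ⟨m, rfl, hm⟩ := exists_shift_of_bumpTrain (height_ne_zero i) (height_ne_zero i) hc
    obtain ⟨k, rfl⟩ := heightPeriod_dvd hm
    exact ⟨k, by push_cast; ring⟩

/-! ## The first two curve pieces -/

lemma exists_eq_two_mul_add_of_mem_Icc {s : ℝ} (hs : s ∈ Icc (0 : ℝ) 8) :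
    ∃ (n : ℕ) (x : ℝ), n < 4 ∧ 0 ≤ x ∧ x ≤ 2 ∧ s = 2 * n + x := by
  rcases le_total s 2 with h | h
  · exact ⟨0, s, by norm_num, hs.1, h, by simp⟩
  rcases le_total s 4 with h' | h'
  · exact ⟨1, s - 2, by norm_num, by linarith, by linarith, by push_cast; ring⟩
  rcases le_total s 6 with h'' | h''
  · exact ⟨2, s - 4, by norm_num, by linarith, by linarith, by push_cast; ring⟩
  · exact ⟨3, s - 6, by norm_num, by linarith, by linarith [hs.2], by push_cast; ring⟩

lemma signatureMap_image_subset {c c' : ℤ → ℤ}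
    (h : ∀ n : ℕ, n < 4 → ∃ m : ℕ, m < 4 ∧ c n = c' m) :
    signatureMap (curveOf (bumpTrain c)) '' Icc 0 8
      ⊆ signatureMap (curveOf (bumpTrain c')) '' Icc 0 8 := by
  rintro _ ⟨s, hs, rfl⟩
  obtain ⟨n, x, hn, h0, h2, rfl⟩ := exists_eq_two_mul_add_of_mem_Icc hs
  obtain ⟨m, hm, hnm⟩ := h n hn
  have hm' : (m : ℝ) + 1 ≤ 4 := by exact_mod_cast hm
  refine ⟨2 * m + x, ⟨by positivity, by linarith⟩, ?_⟩
  have e1 := signatureMap_train c n h0 h2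
  have e2 := signatureMap_train c' m h0 h2
  rw [Int.cast_natCast] at e1 e2
  rw [e1, e2, hnm]

lemma unitBump_lt_one {x : ℝ} (h : x ≠ 1) : unitBump x < 1 :=
  lt_of_le_of_ne (unitBump_le_one x) fun h1 => h (eq_one_of_unitBump_eq_one h1)

lemma bumpTrain_height_zero_mid {y : ℝ} (h1 : 4 ≤ y) (h2 : y ≤ 6) :
    bumpTrain (height 0) y = Real.pi / 3 * (3 * unitBump (y - 4)) := by
  have e := bumpTrain_apply (height 0) 2 (x := y - 4) (by linarith) (by linarith)
  rw [show height 0 2 = 3 from rfl] at e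
  push_cast at e
  rw [← e]
  congr 1
  ring

lemma bumpTrain_height_one_second {y : ℝ} (h1 : 2 ≤ y) (h2 : y ≤ 4) :
    bumpTrain (height 1) y = Real.pi / 3 * (3 * unitBump (y - 2)) := by
  have e := bumpTrain_apply (height 1) 1 (x := y - 2) (by linarith) (by linarith)
  rw [show height 1 1 = 3 from rfl] at e
  push_cast at e
  rw [← e]
  congr 1
  ring

lemma bumpTrain_height_one_third {y : ℝ} (h1 : 4 ≤ y) (h2 : y ≤ 6) :
    bumpTrain (height 1) y = Real.pi / 3 * (-2 * unitBump (y - 4)) := by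
  have e := bumpTrain_apply (height 1) 2 (x := y - 4) (by linarith) (by linarith)
  rw [show height 1 2 = -2 from rfl] at e
  push_cast at e
  rw [← e]
  congr 1
  ring

lemma eq_five_of_bumpTrain_eq {y : ℝ} (hy : y ∈ Icc (0 : ℝ) 8)
    (h : bumpTrain (height 0) y = Real.pi / 3 * 3) : y = 5 := by
  obtain ⟨n, x, hn, h0, h2, rfl⟩ := exists_eq_two_mul_add_of_mem_Icc hy
  have e := bumpTrain_apply (height 0) n h0 h2
  rw [Int.cast_natCast, h] at e
  have e1 := mul_left_cancel₀ (by positivity) e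
  have b0 := unitBump_nonneg x
  have b1 := unitBump_le_one x
  interval_cases n
  · rw [show height 0 ((0 : ℕ) : ℤ) = 1 from rfl] at e1
    push_cast at e1
    linarith
  · rw [show height 0 ((1 : ℕ) : ℤ) = -2 from rfl] at e1
    push_cast at e1
    linarith
  · rw [show height 0 ((2 : ℕ) : ℤ) = 3 from rfl] at e1
    push_cast at e1
    rw [eq_one_of_unitBump_eq_one (x := x) (by linarith)]
    norm_num
  · rw [show height 0 ((3 : ℕ) : ℤ) = -1 from rfl] at e1
    push_cast at e1
    linarith

lemma eq_three_of_bumpTrain_eq {y : ℝ} (hy : y ∈ Icc (0 : ℝ) 8)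
    (h : bumpTrain (height 0) y = Real.pi / 3 * (-2)) : y = 3 := by
  obtain ⟨n, x, hn, h0, h2, rfl⟩ := exists_eq_two_mul_add_of_mem_Icc hy
  have e := bumpTrain_apply (height 0) n h0 h2
  rw [Int.cast_natCast, h] at e
  have e1 := mul_left_cancel₀ (by positivity) e
  have b0 := unitBump_nonneg x
  have b1 := unitBump_le_one x
  interval_cases n
  · rw [show height 0 ((0 : ℕ) : ℤ) = 1 from rfl] at e1
    push_cast at e1
    linarith
  · rw [show height 0 ((1 : ℕ) : ℤ) = -2 from rfl] at e1
    push_cast at e1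
    rw [eq_one_of_unitBump_eq_one (x := x) (by linarith)]
    norm_num
  · rw [show height 0 ((2 : ℕ) : ℤ) = 3 from rfl] at e1
    push_cast at e1
    linarith
  · rw [show height 0 ((3 : ℕ) : ℤ) = -1 from rfl] at e1
    push_cast at e1
    linarith

/-- A continuous map that matches the curvatures sends the bump of height `3` of the second curve
to that of the first one. -/
lemma mem_Ioo_of_matching {ρ : ℝ → ℝ} (hρ : ContinuousOn ρ (Icc 0 8)) (h3 : ρ 3 = 5)
    (hk : ∀ s ∈ Icc (0 : ℝ) 8, bumpTrain (height 1) s = bumpTrain (height 0) (ρ s)) {s : ℝ}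
    (hs : s ∈ Ioo (2 : ℝ) 4) : ρ s ∈ Ioo (4 : ℝ) 6 := by
  have hsub : Ioo (2 : ℝ) 4 ⊆ Icc 0 8 := fun s hs => ⟨by linarith [hs.1], by linarith [hs.2]⟩
  -- The image of $(2,4)$ is an interval containing 5 on which $\kappa_1\ne 0$, so it cannot reach
  -- the zeros 4 and 6.
  have hoc := (isPreconnected_Ioo.image ρ (hρ.mono hsub)).ordConnected
  have hne : ∀ y ∈ ρ '' Ioo (2 : ℝ) 4, bumpTrain (height 0) y ≠ 0 := by
    rintro _ ⟨s, hs, rfl⟩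
    rw [← hk s (hsub hs), bumpTrain_height_one_second hs.1.le hs.2.le]
    have := unitBump_pos (x := s - 2) (by linarith [hs.1]) (by linarith [hs.2])
    positivity
  have h5 : (5 : ℝ) ∈ ρ '' Ioo (2 : ℝ) 4 := ⟨3, ⟨by norm_num, by norm_num⟩, h3⟩
  have z4 : bumpTrain (height 0) 4 = 0 :=
    (bumpTrain_eq_zero_iff (height_ne_zero 0) 4).2 ⟨2, by norm_num⟩
  have z6 : bumpTrain (height 0) 6 = 0 :=
    (bumpTrain_eq_zero_iff (height_ne_zero 0) 6).2 ⟨3, by norm_num⟩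
  have hmem : ρ s ∈ ρ '' Ioo (2 : ℝ) 4 := ⟨s, hs, rfl⟩
  constructor
  · by_contra! h
    exact hne 4 (hoc.out hmem h5 ⟨h, by norm_num⟩) z4
  · by_contra! h
    exact hne 6 (hoc.out h5 hmem ⟨by norm_num, h⟩) z6

theorem not_isCurvatureMatching (ρ : ℝ → ℝ) :
    ¬ IsCurvatureMatching (gamma 0) (gamma 1) (Icc 0 8) (Icc 0 8) ρ := by
  rintro ⟨hρ, hmaps, hd, hk⟩
  rw [gamma_eq] at hd
  rw [gamma_eq, gamma_eq, funext (curvature_curveOf (continuous_bumpTrain _)),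
    funext (curvature_curveOf (continuous_bumpTrain _))] at hk
  have hloop := (height_simpleClosedTrain 0).simpleLoop
  have h3 : ρ 3 = 5 := by
    refine eq_five_of_bumpTrain_eq (hmaps ⟨by norm_num, by norm_num⟩) ?_
    rw [← hk 3 ⟨by norm_num, by norm_num⟩, bumpTrain_height_one_second (by norm_num) (by norm_num),
      show (3 : ℝ) - 2 = 1 by norm_num, unitBump_one, mul_one]
  have h5 : ρ 5 = 3 := by
    refine eq_three_of_bumpTrain_eq (hmaps ⟨by norm_num, by norm_num⟩) ?_
    rw [← hk 5 ⟨by norm_num, by norm_num⟩, bumpTrain_height_one_third (by norm_num) (by norm_num),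
      show (5 : ℝ) - 4 = 1 by norm_num, unitBump_one, mul_one]
  have hder : ∀ s ∈ Ioo (3 : ℝ) 4, HasDerivAt ρ 1 s := by
    intro s hs
    have hsI : s ∈ Icc (0 : ℝ) 8 := ⟨by linarith [hs.1], by linarith [hs.2]⟩
    have hmem := mem_Ioo_of_matching hρ h3 hk (s := s) ⟨by linarith [hs.1], hs.2⟩
    refine (hd s hsI ?_).hasDerivAt (Icc_mem_nhds (by linarith [hs.1]) (by linarith [hs.2]))
    rintro ⟨t, ht, hγ, hv⟩
    rw [curvatureDot_curveOf (continuous_bumpTrain _),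
      deriv_bumpTrain_eq_zero_iff (height_ne_zero 0)] at hv
    obtain ⟨n, rfl⟩ := hv
    -- Vertices are points of the plane; injectivity on one period returns to the parameter. The
    -- only candidate in $(4,6)$ is 5, which is excluded because on $(2,4)$ curvature $\pi$ occurs
    -- only at 3.
    have e : (n : ℝ) = ρ s := hloop.injOn ⟨ht.1, by linarith [ht.2]⟩
      ⟨by linarith [hmem.1], by linarith [hmem.2]⟩ hγ
    have n4 : 4 < n := by
      have := hmem.1
      rw [← e] at this
      exact_mod_cast this
    have n6 : n < 6 := by
      have := hmem.2
      rw [← e] at this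
      exact_mod_cast this
    obtain rfl : n = 5 := by omega
    have e1 := hk s hsI
    rw [← e, bumpTrain_height_one_second (by linarith [hs.1]) hs.2.le] at e1
    push_cast at e1
    rw [bumpTrain_height_zero_mid (by norm_num) (by norm_num),
      show (5 : ℝ) - 4 = 1 by norm_num, unitBump_one] at e1
    have e2 := mul_left_cancel₀ (by positivity) e1
    have e3 := unitBump_lt_one (x := s - 2) (by linarith [hs.1])
    linarith
  have h4 : ρ 4 = 6 := by
    obtain ⟨s, -, hs⟩ := exists_hasDerivAt_eq_slope ρ (fun _ => 1) (by norm_num : (3 : ℝ) < 4)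
      (hρ.mono fun s hs => ⟨by linarith [hs.1], by linarith [hs.2]⟩) hder
    rw [h3] at hs
    norm_num at hs
    linarith
  obtain ⟨s, hs, hs4⟩ := intermediate_value_Icc' (by norm_num : (4 : ℝ) ≤ 5)
    (hρ.mono fun s hs => ⟨by linarith [hs.1], by linarith [hs.2]⟩)
    (show (4 : ℝ) ∈ Icc (ρ 5) (ρ 4) by rw [h5, h4]; norm_num)
  have hs4' : 4 < s := by
    refine lt_of_le_of_ne hs.1 fun h => ?_
    rw [← h, h4] at hs4
    norm_num at hs4
  have e1 := hk s ⟨by linarith, by linarith [hs.2]⟩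
  rw [hs4, bumpTrain_height_one_third hs4'.le (by linarith [hs.2]),
    (bumpTrain_eq_zero_iff (height_ne_zero 0) 4).2 ⟨2, by norm_num⟩] at e1
  have e2 := unitBump_pos (x := s - 4) (by linarith) (by linarith [hs.2])
  have e3 := mul_pos Real.pi_pos e2
  linarith

end SignatureCurves

end

/-! ### Assembly of the main theorem -/

theorem mainTheorem4 :
    -- the curvature functions are smooth and periodic, with minimal periods 8, 8, 16, 24
    (∀ i : Fin 4, ContDiff ℝ ∞ (SignatureCurves.kappa i)) ∧
    (∀ i : Fin 4, SignatureCurves.IsMinimalPeriod (SignatureCurves.kappa i)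
      ((![8, 8, 16, 24] : Fin 4 → ℝ) i)) ∧
    -- on each interval [2n, 2n+2] the first two are shifts of each other, but not globally
    (∀ n : ℤ, ∃ m : ℤ, ∀ s ∈ Set.Icc (0 : ℝ) 2,
      SignatureCurves.kappa₂ (2 * n + s) = SignatureCurves.kappa₁ (2 * m + s)) ∧
    (∀ n : ℤ, ∃ m : ℤ, ∀ s ∈ Set.Icc (0 : ℝ) 2,
      SignatureCurves.kappa₁ (2 * n + s) = SignatureCurves.kappa₂ (2 * m + s)) ∧
    (¬ ∃ c : ℝ, ∀ s : ℝ, SignatureCurves.kappa₂ s = SignatureCurves.kappa₁ (s + c)) ∧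
    -- the four curves are smooth and closed of length 48, with the prescribed curvature,
    -- simple, non-degenerate and of signature index 6
    (∀ i : Fin 4,
      ContDiff ℝ ∞ (SignatureCurves.gamma i) ∧
      SignatureCurves.IsClosedOfLength (SignatureCurves.gamma i) 48 ∧
      (∀ s : ℝ, SignatureCurves.curvature (SignatureCurves.gamma i) s
        = SignatureCurves.kappa i s) ∧
      SignatureCurves.IsSimple (SignatureCurves.gamma i) ∧
      SignatureCurves.IsNonDegenerate (SignatureCurves.gamma i) ∧
      SignatureCurves.signatureIndex (SignatureCurves.gamma i) = 6) ∧
    -- identical signatures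
    (∀ i j : Fin 4, SignatureCurves.signature (SignatureCurves.gamma i)
      = SignatureCurves.signature (SignatureCurves.gamma j)) ∧
    -- pairwise non-congruent
    (∀ i j : Fin 4, i ≠ j →
      ¬ SignatureCurves.Congruent (SignatureCurves.gamma i) (SignatureCurves.gamma j)) ∧
    -- symmetry groups
    Nonempty (SignatureCurves.symmetryGroup (SignatureCurves.gamma 0) ≃*
      Multiplicative (ZMod 6)) ∧
    Nonempty (SignatureCurves.symmetryGroup (SignatureCurves.gamma 1) ≃*
      Multiplicative (ZMod 6)) ∧
    Nonempty (SignatureCurves.symmetryGroup (SignatureCurves.gamma 2) ≃*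
      Multiplicative (ZMod 3)) ∧
    Nonempty (SignatureCurves.symmetryGroup (SignatureCurves.gamma 3) ≃*
      Multiplicative (ZMod 2)) ∧
    -- the first two curves, restricted to [0, 8], have the same signature, but no continuous
    -- map of [0, 8] to itself matches their curvatures
    SignatureCurves.signatureMap (SignatureCurves.gamma 0) '' Set.Icc 0 8
      = SignatureCurves.signatureMap (SignatureCurves.gamma 1) '' Set.Icc 0 8 ∧
    ¬ ∃ ρ : ℝ → ℝ, SignatureCurves.IsCurvatureMatching (SignatureCurves.gamma 0)
      (SignatureCurves.gamma 1) (Set.Icc 0 8) (Set.Icc 0 8) ρ := by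
  refine ⟨fun i => ?_, fun i => ?_, fun n => ?_, fun n => ?_, ?_, fun i => ?_, fun i j => ?_,
    fun i j hij => ?_, ?_, ?_, ?_, ?_, ?_, ?_⟩
  · rw [SignatureCurves.kappa_eq_bumpTrain]
    exact SignatureCurves.contDiff_bumpTrain _
  · rw [SignatureCurves.kappa_eq_bumpTrain]
    convert SignatureCurves.isMinimalPeriod_bumpTrain_height i using 1
    fin_cases i <;> norm_num [SignatureCurves.heightPeriod]
  · exact SignatureCurves.kappa_Icc_shift 1 0 n
  · exact SignatureCurves.kappa_Icc_shift 0 1 n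
  · rintro ⟨c, hc⟩
    change ∀ s, SignatureCurves.kappa 1 s = SignatureCurves.kappa 0 (s + c) at hc
    rw [SignatureCurves.kappa_eq_bumpTrain, SignatureCurves.kappa_eq_bumpTrain] at hc
    obtain ⟨m, -, hm⟩ := SignatureCurves.exists_shift_of_bumpTrain
      (SignatureCurves.height_ne_zero 1) (SignatureCurves.height_ne_zero 0) hc
    exact SignatureCurves.height_not_shift (by decide) m hm
  · have h := SignatureCurves.height_simpleClosedTrain i
    rw [SignatureCurves.gamma_eq, SignatureCurves.kappa_eq_bumpTrain]
    exact ⟨h.simpleLoop.contDiff, ⟨h.simpleLoop.unitSpeed, h.simpleLoop.isMinimalPeriod⟩,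
      SignatureCurves.curvature_curveOf (SignatureCurves.continuous_bumpTrain _),
      h.simpleLoop.isSimple, h.isNonDegenerate,
      h.signatureIndex_eq (SignatureCurves.card_height_eq i)
        (SignatureCurves.exists_height_eq_three i)⟩
  · rw [SignatureCurves.gamma_eq, SignatureCurves.gamma_eq]
    exact Set.Subset.antisymm
      (SignatureCurves.signature_train_subset (SignatureCurves.exists_height_eq i j))
      (SignatureCurves.signature_train_subset (SignatureCurves.exists_height_eq j i))
  · exact SignatureCurves.not_congruent_gamma hij
  · exact SignatureCurves.symmetryGroup_gamma 0 rfl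
  · exact SignatureCurves.symmetryGroup_gamma 1 rfl
  · exact SignatureCurves.symmetryGroup_gamma 2 rfl
  · exact SignatureCurves.symmetryGroup_gamma 3 rfl
  · rw [SignatureCurves.gamma_eq, SignatureCurves.gamma_eq]
    exact Set.Subset.antisymm
      (SignatureCurves.signatureMap_image_subset (by decide +kernel))
      (SignatureCurves.signatureMap_image_subset (by decide +kernel))
  · rintro ⟨ρ, hρ⟩
    exact SignatureCurves.not_isCurvatureMatching ρ hρ
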